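/- Let $k\ge 2$ and let $R=\mathbb{C}[x,y]/(x^k)$, $\mathbb{Z}$-graded by $\deg x=1$ and $\deg y=-1$. For a graded $R$-module $M$ and $n\in\mathbb{Z}$ let $M(n)$ be the shift, $M(n)_d=M_{n+d}$. Let $\mathrm{MCM}_{\mathbb{Z}}R$ be the category (with degree-preserving maps) of finitely generated $\mathbb{Z}$-graded $R$-modules $M$ that are maximal Cohen--Macaulay, i.e. $\operatorname{depth} M_{\mathfrak p}=\dim R_{\mathfrak p}$ for all $\mathfrak p\in\operatorname{Spec}R$ (with the convention that the zero module has depth $\infty$). Let $\mathcal{F}$ be the graded total ring of fractions of $R$, the localization of $R$ at all homogeneous non-zero-divisors; a finitely generated graded module $M$ is generically free of rank $n$ if $M\otimes_R\mathcal{F}$ is a graded free $\mathcal{F}$-module of rank $n$. Let $$\mathcal{A}_k=\mathbb{C}[p_{\underline\ell}\mid \underline\ell\subseteq\mathbb{Z},\ |\underline\ell|=k]/\mathcal{I}_P,$$ where $\mathcal{I}_P$ is generated by the Plücker relations $\sum_{l=0}^{k}(-1)^l\,p_{J'\cup\{j_l\}}\,p_{J\setminus\{j_l\}}$ for $J=\{j_0<\dots<j_k\}\subseteq\mathbb{Z}$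 and $J'\subseteq\mathbb{Z}$ with $|J'|=k-1$. Here $p_{J'\cup\{j_l\}}$ is read as alternating in the tuple consisting of the elements of $J'$ in increasing order followed by $j_l$, so it is $0$ if $j_l\in J'$ and otherwise carries the sign $(-1)^{|\{b\in J'\,:\,b>j_l\}|}$. The images of the $p_{\underline\ell}$ in $\mathcal{A}_k$ are the Plücker coordinates of $\mathcal{A}_k$. Then: 1. A module $M\in\mathrm{MCM}_{\mathbb{Z}}R$ is generically free of rank $1$ if and only if $$M\cong (x^{k-1},x^{k-2}y^{i_1},x^{k-3}y^{i_2},\dots,xy^{i_{k-2}},y^{i_{k-1}})(i_k)$$ as graded modules, for some integers $0\le i_1\le\dots\le i_{k-1}$ and some $i_k\in\mathbb{Z}$. 2. The isomorphism classes of modules in $\mathrm{MCM}_{\mathbb{Z}}R$ that are generically free of rank $1$ are in bijection with the Plücker coordinates of $\mathcal{A}_k$. The bijection and its inverse are given by $I\mapsto p_{\underline\ell(I)}$ and $p_{\underline\ell}\mapsto I(\underline\ell)$. Here, for $I=(x^{k-1},x^{k-2}y^{i_1},\dots,y^{i_{k-1}})(i_k)$ with $0\le i_1\le\dots\le i_{k-1}$,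 $$\underline\ell(I)=\{-i_k-i_{k-1},\ -i_k-i_{k-2}+1,\ \dots,\ -i_k-i_1+k-2,\ -i_k+k-1\}$$ is the set of degrees of the listed generators in $I$, and for $\underline\ell=\{\ell_1<\dots<\ell_k\}$, $$I(\underline\ell)=(x^{k-1},x^{k-2}y^{i_1},\dots,xy^{i_{k-2}},y^{i_{k-1}})(i_k),\qquad i_k=k-1-\ell_k,\quad i_{k-p}=\ell_k-\ell_p-(k-p)\ \ (1\le p\le k-1).$$ In particular all these ideals and shifts lie in $\mathrm{MCM}_{\mathbb{Z}}R$ and are generically free of rank $1$. -/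

import Mathlib

open scoped TensorProduct

universe u v

noncomputable section

namespace GrassInf

/-! ### Maximal Cohen-Macaulay modules -/

/-- The depth of a module over a local ring: the supremum of the lengths of the (weakly) `M`-regular
sequences in the maximal ideal. (For a nonzero finitely generated module weakly regular sequences
in the maximal ideal are regular; the zero module gets depth `∞`.) -/
def moduleDepth (A : Type u) [CommRing A] [IsLocalRing A] (M : Type v) [AddCommGroup M]
    [Module A M] : ℕ∞ :=
  ⨆ (rs : List A) (_ : ∀ r ∈ rs, r ∈ IsLocalRing.maximalIdeal A)
    (_ : RingTheory.Sequence.IsWeaklyRegular M rs), (rs.length : ℕ∞)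

/-- `M` is finitely generated and `depth M_𝔭 = dim A_𝔭` for all primes `𝔭` of `A`. -/
def IsMaximalCohenMacaulay (A : Type u) [CommRing A] (M : Type v) [AddCommGroup M]
    [Module A M] : Prop :=
  Module.Finite A M ∧ ∀ (p : Ideal A) [p.IsPrime],
    ((moduleDepth (Localization.AtPrime p) (LocalizedModule p.primeCompl M) : ℕ∞) : WithBot ℕ∞) =
      ringKrullDim (Localization.AtPrime p)

/-! ### The graded ring `R = ℂ[x,y]/(x^k)`, with `deg x = 1` and `deg y = -1` -/

/-- The ring `ℂ[x,y]/(x^k)`. -/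
abbrev R (k : ℕ) : Type :=
  MvPolynomial (Fin 2) ℂ ⧸ (Ideal.span {(MvPolynomial.X 0) ^ k} : Ideal (MvPolynomial (Fin 2) ℂ))

/-- The class of `x`. -/
def x (k : ℕ) : R k := Ideal.Quotient.mk _ (MvPolynomial.X 0)

/-- The class of `y`. -/
def y (k : ℕ) : R k := Ideal.Quotient.mk _ (MvPolynomial.X 1)

/-- The degrees of `x` and `y`. -/
def wt : Fin 2 → ℤ := ![1, -1]

/-- The homogeneous piece of degree `d` of `R`. -/
def Rdeg (k : ℕ) (d : ℤ) : Submodule ℂ (R k) :=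
  (MvPolynomial.weightedHomogeneousSubmodule ℂ wt d).map
    (Ideal.Quotient.mkₐ ℂ (Ideal.span {(MvPolynomial.X 0 : MvPolynomial (Fin 2) ℂ) ^ k})).toLinearMap

lemma mk_mem_Rdeg {k : ℕ} {d : ℤ} {p : MvPolynomial (Fin 2) ℂ}
    (hp : MvPolynomial.IsWeightedHomogeneous wt p d) :
    (Ideal.Quotient.mk _ p : R k) ∈ Rdeg k d := ⟨p, hp, rfl⟩

lemma x_mem (k : ℕ) : x k ∈ Rdeg k 1 :=
  mk_mem_Rdeg (MvPolynomial.isWeightedHomogeneous_X ℂ wt 0)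

lemma y_mem (k : ℕ) : y k ∈ Rdeg k (-1) :=
  mk_mem_Rdeg (MvPolynomial.isWeightedHomogeneous_X ℂ wt 1)

instance (k : ℕ) : SetLike.GradedMonoid (Rdeg k) where
  one_mem := mk_mem_Rdeg (MvPolynomial.isWeightedHomogeneous_one ℂ wt)
  mul_mem := by
    rintro i j _ _ ⟨p, hp, rfl⟩ ⟨q, hq, rfl⟩
    exact ⟨p * q, MvPolynomial.IsWeightedHomogeneous.mul hp hq, by simp⟩

/-- The algebra map from `ℂ[x,y]` to the direct sum of the pieces `Rdeg k d`. -/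
def toPieces (k : ℕ) : MvPolynomial (Fin 2) ℂ →ₐ[ℂ] DirectSum ℤ (fun d => Rdeg k d) :=
  MvPolynomial.aeval fun v =>
    DirectSum.of (fun d => Rdeg k d) (wt v)
      ⟨Ideal.Quotient.mk _ (MvPolynomial.X v),
        mk_mem_Rdeg (MvPolynomial.isWeightedHomogeneous_X ℂ wt v)⟩

lemma of_eq_of {k : ℕ} {d e : ℤ} (h : d = e) {r : R k} (hr : r ∈ Rdeg k d) (hr' : r ∈ Rdeg k e) :
    DirectSum.of (fun d => Rdeg k d) d ⟨r, hr⟩ = DirectSum.of (fun d => Rdeg k d) e ⟨r, hr'⟩ := by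
  subst h; rfl

lemma toPieces_mul {k : ℕ} {d e : ℤ} {p q : MvPolynomial (Fin 2) ℂ}
    (hp : ∃ h : MvPolynomial.IsWeightedHomogeneous wt p d, toPieces k p =
      DirectSum.of (fun d => Rdeg k d) d ⟨Ideal.Quotient.mk _ p, mk_mem_Rdeg h⟩)
    (hq : ∃ h : MvPolynomial.IsWeightedHomogeneous wt q e, toPieces k q =
      DirectSum.of (fun d => Rdeg k d) e ⟨Ideal.Quotient.mk _ q, mk_mem_Rdeg h⟩) :
    ∃ h : MvPolynomial.IsWeightedHomogeneous wt (p * q) (d + e), toPieces k (p * q) =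
      DirectSum.of (fun d => Rdeg k d) (d + e) ⟨Ideal.Quotient.mk _ (p * q), mk_mem_Rdeg h⟩ := by
  obtain ⟨h1, h2⟩ := hp
  obtain ⟨h3, h4⟩ := hq
  refine ⟨h1.mul h3, ?_⟩
  rw [map_mul, h2, h4, DirectSum.of_mul_of]
  congr 1

lemma toPieces_X_pow (k : ℕ) (v : Fin 2) (n : ℕ) :
    ∃ h : MvPolynomial.IsWeightedHomogeneous wt (MvPolynomial.X v ^ n : MvPolynomial (Fin 2) ℂ)
      (n * wt v), toPieces k (MvPolynomial.X v ^ n) =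
      DirectSum.of (fun d => Rdeg k d) (n * wt v)
        ⟨Ideal.Quotient.mk _ (MvPolynomial.X v ^ n), mk_mem_Rdeg h⟩ := by
  induction n with
  | zero =>
    have h : MvPolynomial.IsWeightedHomogeneous wt
        (MvPolynomial.X v ^ 0 : MvPolynomial (Fin 2) ℂ) (((0 : ℕ) : ℤ) * wt v) := by
      simpa using MvPolynomial.isWeightedHomogeneous_one ℂ wt
    refine ⟨h, ?_⟩
    have h1 : toPieces k (MvPolynomial.X v ^ 0) =
        DirectSum.of (fun d => Rdeg k d) 0 ⟨1, SetLike.GradedOne.one_mem⟩ := by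
      rw [pow_zero, map_one]
      rfl
    rw [h1]
    have h2 : (0 : ℤ) = ((0 : ℕ) : ℤ) * wt v := by rw [Nat.cast_zero, zero_mul]
    have h3 : (1 : R k) ∈ Rdeg k (((0 : ℕ) : ℤ) * wt v) := h2 ▸ SetLike.GradedOne.one_mem
    exact of_eq_of h2 _ h3
  | succ n ih =>
    have h1 : ∃ h : MvPolynomial.IsWeightedHomogeneous wt
        (MvPolynomial.X v : MvPolynomial (Fin 2) ℂ) (wt v), toPieces k (MvPolynomial.X v) =
        DirectSum.of (fun d => Rdeg k d) (wt v)
          ⟨Ideal.Quotient.mk _ (MvPolynomial.X v), mk_mem_Rdeg h⟩ :=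
      ⟨MvPolynomial.isWeightedHomogeneous_X ℂ wt v, by simp [toPieces]⟩
    have h2 := toPieces_mul ih h1
    have h3 : ((n : ℕ) : ℤ) * wt v + wt v = ((n + 1 : ℕ) : ℤ) * wt v := by push_cast; ring
    rw [h3] at h2
    simpa only [pow_succ] using h2

lemma toPieces_apply (k : ℕ) {d : ℤ} {p : MvPolynomial (Fin 2) ℂ}
    (hp : MvPolynomial.IsWeightedHomogeneous wt p d) :
    toPieces k p = DirectSum.of (fun d => Rdeg k d) d ⟨Ideal.Quotient.mk _ p, mk_mem_Rdeg hp⟩ := by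
  induction hp using MvPolynomial.IsWeightedHomogeneous.induction_on with
  | zero =>
    rw [map_zero]
    exact (map_zero (DirectSum.of (fun d => Rdeg k d) d)).symm
  | add p q hp hq ih1 ih2 =>
    rw [map_add, ih1, ih2, ← map_add]
    congr 1
  | monomial e r hr =>
    have h0 : ∃ h : MvPolynomial.IsWeightedHomogeneous wt (MvPolynomial.C r) (0 : ℤ),
        toPieces k (MvPolynomial.C r) =
        DirectSum.of (fun d => Rdeg k d) 0 ⟨Ideal.Quotient.mk _ (MvPolynomial.C r),
          mk_mem_Rdeg h⟩ :=
      ⟨MvPolynomial.isWeightedHomogeneous_C wt r, by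
        rw [toPieces, MvPolynomial.aeval_C]
        rfl⟩
    obtain ⟨h1, h2⟩ := toPieces_mul h0 (toPieces_mul (toPieces_X_pow k 0 (e 0))
      (toPieces_X_pow k 1 (e 1)))
    have h3 : MvPolynomial.monomial e r =
        MvPolynomial.C r * (MvPolynomial.X 0 ^ e 0 * MvPolynomial.X 1 ^ e 1) := by
      rw [MvPolynomial.monomial_eq, Finsupp.prod_fintype _ _ (by simp), Fin.prod_univ_two]
    have h4 : d = 0 + ((e 0 : ℕ) * wt 0 + (e 1 : ℕ) * wt 1) := by
      rw [← hr, Finsupp.weight_apply, Finsupp.sum_fintype _ _ (by simp), Fin.sum_univ_two]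
      simp
    subst h4
    simp only [h3]
    exact h2

instance (k : ℕ) : GradedAlgebra (Rdeg k) :=
  GradedAlgebra.ofAlgHom (Rdeg k)
    (Ideal.Quotient.liftₐ _ (toPieces k) (by
      intro a ha
      obtain ⟨b, rfl⟩ := Ideal.mem_span_singleton.1 ha
      obtain ⟨h, h'⟩ := toPieces_X_pow k 0 k
      rw [map_mul, h']
      have h0 : (⟨Ideal.Quotient.mk _ (MvPolynomial.X 0 ^ k), mk_mem_Rdeg h⟩ :
          Rdeg k (k * wt 0)) = 0 :=
        Subtype.ext (Ideal.Quotient.eq_zero_iff_mem.2 (Ideal.mem_span_singleton_self _))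
      rw [h0, map_zero, zero_mul]))
    (by
      apply Ideal.Quotient.algHom_ext
      apply MvPolynomial.algHom_ext
      intro v
      change DirectSum.coeAlgHom (Rdeg k) (toPieces k (MvPolynomial.X v)) =
        Ideal.Quotient.mk _ (MvPolynomial.X v)
      rw [toPieces, MvPolynomial.aeval_X, DirectSum.coeAlgHom_of])
    (by
      rintro i ⟨_, p, hp, rfl⟩
      exact toPieces_apply k hp)

/-! ### Graded modules -/

/-- A `ℤ`-graded `R`-module. -/
structure GrMod (k : ℕ) : Type (u + 1) where
  carrier : Type u
  [addCommGroup : AddCommGroup carrier]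
  [module : Module (R k) carrier]
  /-- the homogeneous pieces -/
  deg : ℤ → AddSubgroup carrier
  isInternal : DirectSum.IsInternal deg
  smul_mem : ∀ {i j : ℤ} {r : R k} {m : carrier},
    r ∈ Rdeg k i → m ∈ deg j → r • m ∈ deg (i + j)

attribute [instance] GrMod.addCommGroup GrMod.module

variable {k : ℕ}

/-- Isomorphism of graded modules: an `R`-linear bijection preserving degrees. -/
def GrMod.Iso (M : GrMod.{u} k) (N : GrMod.{v} k) : Prop :=
  ∃ e : M.carrier ≃ₗ[R k] N.carrier, ∀ (d : ℤ) (m : M.carrier), e m ∈ N.deg d ↔ m ∈ M.deg d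

lemma isInternal_of {M : Type u} [AddCommGroup M] {A : ℤ → AddSubgroup M} (h1 : iSupIndep A)
    (h2 : iSup A = ⊤) : DirectSum.IsInternal A := by
  refine ⟨h1.dfinsuppSumAddHom_injective, ?_⟩
  refine AddMonoidHom.range_eq_top.1 (top_le_iff.1 (h2 ▸ iSup_le fun i m hm => ?_))
  exact ⟨DirectSum.of (fun i => A i) i ⟨m, hm⟩, DirectSum.coeAddMonoidHom_of A i ⟨m, hm⟩⟩

lemma iSup_of_isInternal {M : Type u} [AddCommGroup M] {A : ℤ → AddSubgroup M}
    (h : DirectSum.IsInternal A) : iSup A = ⊤ := by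
  rw [eq_top_iff]
  rintro m -
  obtain ⟨z, rfl⟩ := h.surjective m
  induction z using DirectSum.induction_on with
  | zero => rw [map_zero]; exact zero_mem _
  | of i a =>
    rw [DirectSum.coeAddMonoidHom_of]
    exact AddSubgroup.mem_iSup_of_mem i a.2
  | add a b ha hb => rw [map_add]; exact add_mem ha hb

lemma ideal_isInternal (I : Ideal (R k)) (hI : I.IsHomogeneous (Rdeg k)) :
    DirectSum.IsInternal
      (fun d => (Rdeg k d).toAddSubgroup.comap I.subtype.toAddMonoidHom) := by
  have hR : iSupIndep (fun d => (Rdeg k d).toAddSubgroup) := by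
    have h : DirectSum.IsInternal (fun d => (Rdeg k d).toAddSubgroup) :=
      DirectSum.Decomposition.isInternal (Rdeg k)
    exact h.addSubgroup_iSupIndep
  refine isInternal_of ?_ ?_
  · intro d
    rw [AddSubgroup.disjoint_def]
    intro m hm hm'
    have h1 : (⨆ (j) (_ : j ≠ d),
          (Rdeg k j).toAddSubgroup.comap I.subtype.toAddMonoidHom) ≤
        (⨆ (j) (_ : j ≠ d), (Rdeg k j).toAddSubgroup).comap I.subtype.toAddMonoidHom :=
      iSup₂_le fun j hj => AddSubgroup.comap_mono
        (le_iSup₂ (f := fun j (_ : j ≠ d) => (Rdeg k j).toAddSubgroup) j hj)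
    have h2 : (m : R k) = 0 := AddSubgroup.disjoint_def.1 (hR d) hm (h1 hm')
    exact Subtype.ext h2
  · classical
    rw [eq_top_iff]
    rintro m -
    have h3 : m = ∑ i ∈ (DirectSum.decompose (Rdeg k) (m : R k)).support,
        (⟨DirectSum.decompose (Rdeg k) (m : R k) i, hI i m.2⟩ : I) := by
      apply Subtype.ext
      rw [AddSubmonoidClass.coe_finsetSum]
      exact (DirectSum.sum_support_decompose (Rdeg k) (m : R k)).symm
    rw [h3]
    refine AddSubgroup.sum_mem _ fun i _ => ?_
    exact AddSubgroup.mem_iSup_of_mem i (SetLike.coe_mem (DirectSum.decompose (Rdeg k) (m : R k) i))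

/-- The shift `M(n)`, with `M(n)_d = M_{d+n}`. -/
def GrMod.shift (M : GrMod.{u} k) (n : ℤ) : GrMod.{u} k where
  carrier := M.carrier
  deg d := M.deg (d + n)
  isInternal := by
    refine isInternal_of
      (M.isInternal.addSubgroup_iSupIndep.comp (add_left_injective n)) ?_
    exact (Equiv.iSup_comp (g := M.deg) (Equiv.addRight n)).trans (iSup_of_isInternal M.isInternal)
  smul_mem := by
    intro i j r m hr hm
    rw [add_assoc]
    exact M.smul_mem hr hm

/-- A homogeneous ideal as a graded module. -/
def GrMod.ofIdeal (I : Ideal (R k)) (hI : I.IsHomogeneous (Rdeg k)) : GrMod.{0} k where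
  carrier := I
  deg d := (Rdeg k d).toAddSubgroup.comap I.subtype.toAddMonoidHom
  isInternal := ideal_isInternal I hI
  smul_mem := by
    intro i j r m hr hm
    exact SetLike.mul_mem_graded hr hm

/-- A graded module is MCM if the underlying module is. -/
def GrMod.IsMCM (M : GrMod.{u} k) : Prop := IsMaximalCohenMacaulay (R k) M.carrier

/-! ### Generically free modules -/

/-- The homogeneous non-zero-divisors of `R`. -/
def homogeneousNZD (k : ℕ) : Submonoid (R k) :=
  nonZeroDivisors (R k) ⊓ SetLike.homogeneousSubmonoid (Rdeg k)

/-- The graded total ring of fractions of `R`. -/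
abbrev F (k : ℕ) : Type := Localization (homogeneousNZD k)

/-- The degree `d` piece of the graded total ring of fractions, generated by the fractions `a / s`
with `a`, `s` homogeneous and `deg a - deg s = d`. -/
def Fdeg (k : ℕ) (d : ℤ) : AddSubgroup (F k) :=
  AddSubgroup.closure {z | ∃ (i j : ℤ) (a : R k) (s : homogeneousNZD k),
    a ∈ Rdeg k i ∧ (s : R k) ∈ Rdeg k j ∧ i - j = d ∧ z = Localization.mk a s}

/-- The degree `d` piece of `F ⊗ M`, generated by the `f ⊗ m` with `f`, `m` homogeneous and
`deg f + deg m = d`. -/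
def GrMod.genericDeg (M : GrMod.{u} k) (d : ℤ) : AddSubgroup (F k ⊗[R k] M.carrier) :=
  AddSubgroup.closure {z | ∃ (i j : ℤ) (f : F k) (m : M.carrier),
    f ∈ Fdeg k i ∧ m ∈ M.deg j ∧ i + j = d ∧ z = f ⊗ₜ[R k] m}

/-- `M` is generically free of rank `n`: the graded `F`-module `F ⊗ M` is graded free of rank `n`,
that is, it has an `F`-basis of `n` homogeneous elements. -/
def GrMod.IsGenericallyFree (M : GrMod.{u} k) (n : ℕ) : Prop :=
  ∃ b : Module.Basis (Fin n) (F k) (F k ⊗[R k] M.carrier),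
    ∀ t, ∃ d, b t ∈ M.genericDeg d

/-! ### The monomial ideals -/

/-- The generators of the ideal `(x^(k-1), x^(k-2) y^(i_1), …, x y^(i_(k-2)), y^(i_(k-1)))`;
the exponent `i_(p+1)` is `i p`, for `p = 0, …, k-2`. -/
def monomialGens (i : Fin (k - 1) →o ℕ) : Set (R k) :=
  {x k ^ (k - 1)} ∪ Set.range fun p : Fin (k - 1) => x k ^ (k - 2 - (p : ℕ)) * y k ^ i p

lemma monomialIdeal_isHomogeneous (i : Fin (k - 1) →o ℕ) :
    (Ideal.span (monomialGens i)).IsHomogeneous (Rdeg k) := by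
  refine Ideal.homogeneous_span _ _ ?_
  rintro _ (rfl | ⟨p, rfl⟩)
  · exact ⟨_, SetLike.pow_mem_graded _ (x_mem k)⟩
  · exact ⟨_, SetLike.mul_mem_graded (SetLike.pow_mem_graded _ (x_mem k))
      (SetLike.pow_mem_graded _ (y_mem k))⟩

/-- The graded module `(x^(k-1), x^(k-2) y^(i_1), …, x y^(i_(k-2)), y^(i_(k-1)))(n)`. -/
def monomialModule (i : Fin (k - 1) →o ℕ) (n : ℤ) : GrMod.{0} k :=
  (GrMod.ofIdeal (Ideal.span (monomialGens i)) (monomialIdeal_isHomogeneous i)).shift n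

/-- The degrees in `(x^(k-1), x^(k-2) y^(i_1), …, y^(i_(k-1)))(n)` of the generators:
`-n + k - 1` for `x^(k-1)`, and `-n - i_(p+1) + k - 2 - p` for `x^(k-2-p) y^(i_(p+1))`. -/
def ellFinset (i : Fin (k - 1) →o ℕ) (n : ℤ) : Finset ℤ :=
  insert (-n + (k : ℤ) - 1)
    (Finset.univ.image fun p : Fin (k - 1) => -n - (i p : ℤ) + ((k : ℤ) - 2 - ((p : ℕ) : ℤ)))

lemma ellFinset_card (hk : 2 ≤ k) (i : Fin (k - 1) →o ℕ) (n : ℤ) : (ellFinset i n).card = k := by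
  have hlt : ∀ p q : Fin (k - 1), p < q → (i p : ℤ) ≤ i q ∧ ((p : ℕ) : ℤ) < ((q : ℕ) : ℤ) :=
    fun p q h => ⟨by exact_mod_cast i.monotone h.le, by exact_mod_cast h⟩
  rw [ellFinset, Finset.card_insert_of_notMem, Finset.card_image_of_injective]
  · simp only [Finset.card_univ, Fintype.card_fin]
    omega
  · intro p q h
    dsimp only at h
    rcases lt_trichotomy p q with hpq | hpq | hpq
    · have := hlt p q hpq
      omega
    · exact hpq
    · have := hlt q p hpq
      omega
  · intro h
    obtain ⟨p, -, hp⟩ := Finset.mem_image.1 h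
    omega

/-- The `k`-subset of `ℤ` attached to the module `monomialModule i n`. -/
def ell (hk : 2 ≤ k) (i : Fin (k - 1) →o ℕ) (n : ℤ) : Set.powersetCard ℤ k :=
  ⟨ellFinset i n, ellFinset_card hk i n⟩

/-- The `p`-th smallest element of a `k`-subset of `ℤ`, for `p = 0, …, k-1`. -/
def entry (s : Set.powersetCard ℤ k) (p : Fin k) : ℤ := s.1.orderEmbOfFin s.2 p

lemma entry_add_le (s : Set.powersetCard ℤ k) {a b : Fin k} (h : a ≤ b) :
    entry s a + ((b : ℕ) : ℤ) - ((a : ℕ) : ℤ) ≤ entry s b := by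
  obtain ⟨a, ha⟩ := a
  obtain ⟨b, hb⟩ := b
  have h' : a ≤ b := h
  induction b, h' using Nat.le_induction with
  | base => simp
  | succ b hab ih =>
    have h1 := ih (by omega) hab
    have h2 : entry s ⟨b, by omega⟩ < entry s ⟨b + 1, hb⟩ :=
      (s.1.orderEmbOfFin s.2).strictMono (Fin.mk_lt_mk.2 (Nat.lt_succ_self b))
    push_cast at h1 ⊢
    omega

/-- The exponents of the ideal attached to the `k`-subset `ℓ_1 < … < ℓ_k`: with `q = p + 1`,
`i_q = ℓ_k - ℓ_(k-q) - q` (a nonnegative integer). -/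
def exponents (hk : 2 ≤ k) (s : Set.powersetCard ℤ k) : Fin (k - 1) →o ℕ where
  toFun p := (entry s ⟨k - 1, by omega⟩ - entry s ⟨k - 2 - p, by omega⟩ - ((p : ℕ) + 1 : ℤ)).toNat
  monotone' := by
    intro p q hpq
    have hpq' : (p : ℕ) ≤ q := hpq
    have hq := q.2
    have h := entry_add_le s (a := ⟨k - 2 - q, by omega⟩) (b := ⟨k - 2 - p, by omega⟩)
      (Fin.mk_le_mk.2 (by omega))
    dsimp only at h
    apply Int.toNat_le_toNat
    omega

/-- The graded module attached to the `k`-subset `ℓ_1 < … < ℓ_k`: the monomial ideal with the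
exponents above, shifted by `i_k = k - 1 - ℓ_k`. -/
def moduleOf (hk : 2 ≤ k) (s : Set.powersetCard ℤ k) : GrMod.{0} k :=
  monomialModule (exponents hk s) ((k : ℤ) - 1 - entry s ⟨k - 1, by omega⟩)

/-! ### Isomorphism classes -/

/-- The generically free modules of rank one in the category of graded MCM modules. -/
def RankOneModule (k : ℕ) : Type 1 :=
  {M : GrMod.{0} k // M.IsMCM ∧ M.IsGenericallyFree 1}

instance rankOneSetoid (k : ℕ) : Setoid (RankOneModule k) where
  r M N := M.1.Iso N.1
  iseqv :=
    { refl := fun _ => ⟨LinearEquiv.refl _ _, fun _ _ => Iff.rfl⟩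
      symm := by
        rintro M N ⟨e, he⟩
        exact ⟨e.symm, fun d m => by rw [← he, LinearEquiv.apply_symm_apply]⟩
      trans := by
        rintro M N P ⟨e, he⟩ ⟨f, hf⟩
        exact ⟨e.trans f, fun d m => by rw [LinearEquiv.trans_apply, hf, he]⟩ }

/-- Isomorphism classes of generically free modules of rank one in the category of graded MCM
modules. -/
def RankOneClass (k : ℕ) : Type 1 := Quotient (rankOneSetoid k)

/-- The isomorphism class of a module. -/
def classOf (M : GrMod.{0} k) (h : M.IsMCM ∧ M.IsGenericallyFree 1) : RankOneClass k :=
  Quotient.mk (rankOneSetoid k) ⟨M, h⟩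

/-! ### Plücker coordinates -/

/-- The variable `x_s`, with `x_s = 0` if `s` does not have `k` elements. -/
def pluckerVar (k : ℕ) (s : Finset ℤ) : MvPolynomial (Set.powersetCard ℤ k) ℂ :=
  if h : s.card = k then MvPolynomial.X ⟨s, h⟩ else 0

/-- The Plücker relation of `J = {j_0 < … < j_k}` and `J'`, `∑ (-1)^l x_{J' ∪ {j_l}} x_{J \ {j_l}}`,
where as usual `x_{J' ∪ {j}}` is alternating in the tuple `(J', j)`: it is zero for `j ∈ J'`, and
otherwise sorting `(J', j)` contributes the sign `(-1)^#{b ∈ J' | j < b}`. -/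
def pluckerRelation (k : ℕ) (J J' : Finset ℤ) : MvPolynomial (Set.powersetCard ℤ k) ℂ :=
  ∑ j ∈ J, (-1) ^ ((J.filter (· < j)).card + (J'.filter (j < ·)).card) *
    (pluckerVar k (insert j J') * pluckerVar k (J.erase j))

/-- The ideal generated by the Plücker relations. -/
def pluckerIdeal (k : ℕ) : Ideal (MvPolynomial (Set.powersetCard ℤ k) ℂ) :=
  Ideal.span {f | ∃ J J' : Finset ℤ, J.card = k + 1 ∧ J'.card + 1 = k ∧ f = pluckerRelation k J J'}

/-- The ring `ℂ[p_s | s ⊆ ℤ, |s| = k] / (Plücker relations)`. -/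
abbrev PluckerAlgebra (k : ℕ) : Type := MvPolynomial (Set.powersetCard ℤ k) ℂ ⧸ pluckerIdeal k

/-- The Plücker coordinate `p_s`. -/
def pluckerCoord (s : Set.powersetCard ℤ k) : PluckerAlgebra k :=
  Ideal.Quotient.mk _ (MvPolynomial.X s)

/-- The set of Plücker coordinates, as elements of the ring. -/
abbrev PluckerCoordinates (k : ℕ) : Set (PluckerAlgebra k) :=
  Set.range (pluckerCoord : Set.powersetCard ℤ k → PluckerAlgebra k)

end GrassInf

end

/-!
Up to units, the homogeneous non-zero-divisors of `R = ℂ[x,y]/(x^k)` are the powers of `y`, because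
`xy` is a nilpotent element of degree zero (`exists_eq_monomial_mul_unit`, `exists_mul_eq_y_pow`).
So a graded module `M` is generically free of rank one iff a homogeneous `g ∈ M` with zero
annihilator generates `M` up to powers of `y` (`isGenericallyFree_one_iff`). If `M` is also maximal
Cohen-Macaulay, then `y` is regular on it (`y_smul_injective`), and `y ^ N • m = φ m • g` defines an
isomorphism `φ` of `M` onto a homogeneous ideal containing `y ^ N`, up to a shift
(`exists_iso_ofIdeal`). Such an ideal is generated by monomials `x ^ a * y ^ j a` with `j` antitone
(`exists_eq_stairIdeal`); dividing by `y ^ j (k - 1)` gives one of the listed ideals. Conversely,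
an ideal containing a power of `y` is maximal Cohen-Macaulay because `R` has dimension one and every
prime of height one contains a non-zero-divisor (`isMaximalCohenMacaulay_ideal`).

For the classification up to isomorphism, the degree `ℓ` of the generator with `x`-exponent `a` is
the largest degree in which `(xy) ^ (k - 1 - a)` acts as a nonzero map (`xy_pow_smul_eq_zero_iff`).
Thus the graded module determines the set of degrees, and `s ↦ moduleOf s` is a bijection onto the
isomorphism classes (`classOf_moduleOf_bijective`). Finally, distinct subsets have distinct Plücker
coordinates, because the relations have no linear terms (`pluckerCoord_injective`).
-/

noncomputable section

namespace GrassInf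

/-! ### Depth and dimension -/

/-- Each member of a regular sequence lowers the dimension of the support by one. -/
lemma moduleDepth_le_ringKrullDim (A : Type u) [CommRing A] [IsLocalRing A] [IsNoetherianRing A]
    (M : Type v) [AddCommGroup M] [Module A M] [Module.Finite A M] [Nontrivial M] :
    ((moduleDepth A M : ℕ∞) : WithBot ℕ∞) ≤ ringKrullDim A := by
  obtain ⟨d, hd⟩ : ∃ d : ℕ∞, ringKrullDim A = d :=
    ⟨_, (IsLocalRing.maximalIdeal_height_eq_ringKrullDim (R := A)).symm⟩
  rw [hd, WithBot.coe_le_coe]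
  refine iSup_le fun rs => iSup₂_le fun hmem hreg => ?_
  have hreg' := RingTheory.Sequence.IsRegular.of_isWeaklyRegular_of_mem_maximalIdeal M hmem hreg
  have h := Module.supportDim_add_length_eq_supportDim_of_isRegular rs hreg'
  have h' := Module.supportDim_le_ringKrullDim A M
  rw [← h, hd] at h'
  have hnt : Nontrivial (M ⧸ Ideal.ofList rs • (⊤ : Submodule A M)) :=
    RingTheory.Sequence.IsRegular.quot_ofList_smul_nontrivial hreg' ⊤
  have h0 : 0 ≤ Module.supportDim A (M ⧸ Ideal.ofList rs • (⊤ : Submodule A M)) := by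
    obtain ⟨e, he⟩ := WithBot.ne_bot_iff_exists.1
      ((Module.supportDim_ne_bot_iff_nontrivial A _).2 hnt)
    rw [← he]
    exact WithBot.coe_le_coe.2 zero_le
  have h1 : ((rs.length : ℕ∞) : WithBot ℕ∞) ≤ d := by
    refine le_trans ?_ h'
    exact le_add_of_nonneg_left h0
  exact WithBot.coe_le_coe.1 h1

lemma one_le_moduleDepth {A : Type u} [CommRing A] [IsLocalRing A] {M : Type v} [AddCommGroup M]
    [Module A M] {r : A} (hr : r ∈ IsLocalRing.maximalIdeal A) (hreg : IsSMulRegular M r) :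
    1 ≤ moduleDepth A M := by
  have h : ((([r] : List A).length : ℕ∞)) ≤ moduleDepth A M :=
    le_iSup_of_le [r] (le_iSup₂_of_le (by simpa using hr)
      ((RingTheory.Sequence.isWeaklyRegular_singleton_iff M r).2 hreg) le_rfl)
  simpa using h

lemma exists_isSMulRegular_of_moduleDepth_ne_zero {A : Type u} [CommRing A] [IsLocalRing A]
    {M : Type v} [AddCommGroup M] [Module A M] (h : moduleDepth A M ≠ 0) :
    ∃ r ∈ IsLocalRing.maximalIdeal A, IsSMulRegular M r := by
  by_contra! hcon
  apply h
  rw [← nonpos_iff_eq_zero]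
  refine iSup_le fun rs => iSup₂_le fun hmem hreg => ?_
  cases rs with
  | nil => simp
  | cons r rs =>
    exact absurd ((RingTheory.Sequence.isWeaklyRegular_cons_iff M r rs).1 hreg).1
      (hcon r (hmem r (by simp)))

/-! ### Elements of `ℂ[x,y]/(x^k)` -/

variable {k : ℕ}

lemma mk_eq_zero_iff {p : MvPolynomial (Fin 2) ℂ} :
    (Ideal.Quotient.mk _ p : R k) = 0 ↔ MvPolynomial.X 0 ^ k ∣ p := by
  rw [Ideal.Quotient.eq_zero_iff_mem, Ideal.mem_span_singleton]

lemma x_pow_self (k : ℕ) : x k ^ k = 0 :=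
  (map_pow _ _ _).symm.trans (mk_eq_zero_iff.2 dvd_rfl)

lemma x_pow_eq_zero {a : ℕ} (h : k ≤ a) : x k ^ a = 0 :=
  pow_eq_zero_of_le h (x_pow_self k)

lemma isNilpotent_x (k : ℕ) : IsNilpotent (x k) := ⟨k, x_pow_self k⟩

lemma not_X_dvd_X_pow (b : ℕ) :
    ¬ (MvPolynomial.X 0 : MvPolynomial (Fin 2) ℂ) ∣ MvPolynomial.X 1 ^ b := fun h => by
  have h1 := MvPolynomial.X_prime.dvd_of_dvd_pow h
  rw [MvPolynomial.X_dvd_X] at h1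
  simp at h1

/-- The ideal `(x ^ k)` of the polynomial ring is primary with radical `(x)`, so the zero-divisors
of `R` all lie in `(x)`. -/
lemma mem_nonZeroDivisors_of_notMem {r : R k} (hr : r ∉ Ideal.span {x k}) :
    r ∈ nonZeroDivisors (R k) := by
  obtain ⟨f, rfl⟩ := Ideal.Quotient.mk_surjective r
  rw [mem_nonZeroDivisors_iff_right]
  intro s hs
  obtain ⟨g, rfl⟩ := Ideal.Quotient.mk_surjective s
  rw [← map_mul, mk_eq_zero_iff, mul_comm] at hs
  refine mk_eq_zero_iff.2 (MvPolynomial.X_prime.pow_dvd_of_dvd_mul_left k ?_ hs)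
  rintro ⟨h, rfl⟩
  apply hr
  rw [map_mul]
  exact Ideal.mul_mem_right _ _ (Ideal.mem_span_singleton_self _)

lemma y_pow_notMem (hk : k ≠ 0) (b : ℕ) : y k ^ b ∉ Ideal.span {x k} := by
  rw [Ideal.mem_span_singleton]
  rintro ⟨s, hs⟩
  obtain ⟨g, rfl⟩ := Ideal.Quotient.mk_surjective s
  have h : (Ideal.Quotient.mk _ (MvPolynomial.X 1 ^ b - MvPolynomial.X 0 * g) : R k) = 0 := by
    rw [map_sub, map_mul, map_pow, sub_eq_zero]
    exact hs
  rw [mk_eq_zero_iff] at h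
  exact not_X_dvd_X_pow b ((dvd_sub_left (dvd_mul_right _ _)).1 ((dvd_pow_self _ hk).trans h))

lemma y_pow_mem_nonZeroDivisors (hk : k ≠ 0) (b : ℕ) : y k ^ b ∈ nonZeroDivisors (R k) :=
  mem_nonZeroDivisors_of_notMem (y_pow_notMem hk b)

lemma x_pow_ne_zero {a : ℕ} (h : a < k) : x k ^ a ≠ 0 := fun h0 => by
  have h1 := mk_eq_zero_iff.1 ((map_pow _ _ _).trans h0)
  exact absurd ((pow_dvd_pow_iff MvPolynomial.X_prime.ne_zero
    MvPolynomial.X_prime.not_isUnit).1 h1) (by omega)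

lemma x_pow_mul_y_pow_ne_zero {a : ℕ} (h : a < k) (b : ℕ) : x k ^ a * y k ^ b ≠ 0 := fun h0 =>
  x_pow_ne_zero h
    ((mem_nonZeroDivisors_iff_right.1 (y_pow_mem_nonZeroDivisors (by omega) b)) _ h0)

lemma nontrivial_R (hk : k ≠ 0) : Nontrivial (R k) :=
  ⟨⟨1, 0, by simpa using x_pow_ne_zero (k := k) (a := 0) (by omega)⟩⟩

lemma x_mem_of_isPrime (p : Ideal (R k)) [p.IsPrime] : x k ∈ p :=
  Ideal.IsPrime.mem_of_pow_mem ‹_› k (by rw [x_pow_self]; exact p.zero_mem)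

lemma ringKrullDim_R_le_one (hk : k ≠ 0) : ringKrullDim (R k) ≤ 1 := by
  have h1 : (MvPolynomial.X 0 ^ k : MvPolynomial (Fin 2) ℂ) ∈
      nonZeroDivisors (MvPolynomial (Fin 2) ℂ) :=
    mem_nonZeroDivisors_of_ne_zero (pow_ne_zero _ MvPolynomial.X_prime.ne_zero)
  have h2 := ringKrullDim_quotient_succ_le_of_nonZeroDivisor h1
  rw [MvPolynomial.ringKrullDim_of_isNoetherianRing, ringKrullDim_eq_zero_of_field] at h2
  have := nontrivial_R hk
  obtain ⟨d, hd⟩ : ∃ d : ℕ∞, ringKrullDim (R k) = d :=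
    (WithBot.ne_bot_iff_exists.1 fun h =>
      absurd (h ▸ ringKrullDim_nonneg_of_nontrivial (R := R k)) (by simp)).imp fun _ => Eq.symm
  rw [hd] at h2 ⊢
  simp only [zero_add, Nat.card_eq_fintype_card, Fintype.card_fin] at h2
  have h3 : d + 1 ≤ 2 := WithBot.coe_le_coe.1 h2
  have h4 : d ≤ 1 := by
    have : d + 1 ≤ 1 + 1 := by rwa [one_add_one_eq_two]
    exact (ENat.add_le_add_iff_right (by simp)).1 this
  exact_mod_cast h4

lemma exists_nonZeroDivisor_of_height_ne_zero (p : Ideal (R k)) [p.IsPrime] (h : p.height ≠ 0) :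
    ∃ f ∈ p, f ∈ nonZeroDivisors (R k) := by
  by_contra! hcon
  apply h
  rw [Ideal.height_eq_zero_iff]
  have hp : p ≤ Ideal.span {x k} := fun f hf => by
    by_contra hf'
    exact hcon f hf (mem_nonZeroDivisors_of_notMem hf')
  refine ⟨⟨‹_›, bot_le⟩, fun q hq _ => hp.trans ?_⟩
  have := hq.1
  rw [Ideal.span_singleton_le_iff_mem]
  exact x_mem_of_isPrime q

/-- An ideal containing a non-zero-divisor is maximal Cohen-Macaulay: its localizations are nonzero,
so their depth is at most the dimension, and `R` has dimension one and no embedded primes. -/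
lemma isMaximalCohenMacaulay_ideal (hk : k ≠ 0) (I : Ideal (R k)) {z : R k} (hz : z ∈ I)
    (hz' : z ∈ nonZeroDivisors (R k)) : IsMaximalCohenMacaulay (R k) I := by
  refine ⟨inferInstance, fun p _ => le_antisymm ?_ ?_⟩
  · have : Nontrivial (LocalizedModule p.primeCompl I) := by
      refine ⟨⟨LocalizedModule.mkLinearMap p.primeCompl I ⟨z, hz⟩, 0, fun h => ?_⟩⟩
      rw [IsLocalizedModule.eq_zero_iff p.primeCompl] at h
      obtain ⟨c, hc⟩ := h
      have h1 : (c : R k) * z = 0 := congrArg Subtype.val hc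
      have h2 := (mem_nonZeroDivisors_iff_right.1 hz') _ h1
      exact c.2 (h2 ▸ p.zero_mem)
    exact moduleDepth_le_ringKrullDim _ _
  · rw [IsLocalization.AtPrime.ringKrullDim_eq_height p, WithBot.coe_le_coe]
    by_cases h0 : p.height = 0
    · rw [h0]
      exact zero_le
    · have h1 : p.height ≤ 1 := by
        have := (Ideal.height_le_ringKrullDim_of_ne_top (Ideal.IsPrime.ne_top ‹_›)).trans
          (ringKrullDim_R_le_one hk) (a := (p.height : WithBot ℕ∞))
        exact_mod_cast this
      obtain ⟨f, hf, hf'⟩ := exists_nonZeroDivisor_of_height_ne_zero p h0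
      refine h1.trans (one_le_moduleDepth (r := algebraMap (R k) _ f) ?_ ?_)
      · exact (IsLocalization.AtPrime.to_map_mem_maximal_iff _ p f).2 hf
      · refine IsSMulRegular.of_isLocalizedModule (Localization.AtPrime p) p.primeCompl
          (LocalizedModule.mkLinearMap p.primeCompl I) ?_
        intro a b hab
        apply Subtype.ext
        have h2 : f * (a : R k) = f * b := congrArg Subtype.val hab
        rw [← sub_eq_zero] at h2 ⊢
        rw [← mul_sub] at h2
        exact (mem_nonZeroDivisors_iff_left.1 hf') _ h2

/-- On a maximal Cohen-Macaulay module `y` is a non-zero-divisor: otherwise the module contains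
a nonzero element killed by the maximal ideal `(x, y)`, so the depth at `(x, y)` is zero, whereas
the dimension is one. -/
lemma y_smul_injective (hk : k ≠ 0) {M : Type v} [AddCommGroup M] [Module (R k) M]
    (hM : IsMaximalCohenMacaulay (R k) M) {m : M} (hm : y k • m = 0) : m = 0 := by
  by_contra hm0
  obtain ⟨p, hp, hmp⟩ := exists_le_isAssociatedPrime_of_isNoetherianRing (R k) m hm0
  obtain ⟨hprime, m', hm'⟩ := (isAssociatedPrime_iff).1 hp
  have hmem : ∀ a, a ∈ p ↔ a • m' = 0 := fun a => by
    rw [hm', Submodule.mem_colon_singleton, Submodule.mem_bot]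
  have hyp : y k ∈ p := hmp (by rwa [Submodule.mem_colon_singleton, Submodule.mem_bot])
  have hheight : p.height ≠ 0 := fun h0 =>
    Set.disjoint_left.1
      (Ideal.disjoint_nonZeroDivisors_of_mem_minimalPrimes (Ideal.height_eq_zero_iff.1 h0)) hyp
      (by simpa using y_pow_mem_nonZeroDivisors hk 1)
  have hdepth : moduleDepth (Localization.AtPrime p) (LocalizedModule p.primeCompl M) ≠ 0 :=
    fun h0 => hheight (by
      have h := hM.2 p
      rw [IsLocalization.AtPrime.ringKrullDim_eq_height p, h0, WithBot.coe_inj] at h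
      exact h.symm)
  obtain ⟨r, hr, hreg⟩ := exists_isSMulRegular_of_moduleDepth_ne_zero hdepth
  obtain ⟨a, s, rfl⟩ := IsLocalization.exists_mk'_eq p.primeCompl r
  rw [IsLocalization.AtPrime.mk'_mem_maximal_iff _ p, hmem] at hr
  have h1 : LocalizedModule.mk m' (1 : p.primeCompl) = 0 := by
    apply hreg.right_eq_zero_of_smul
    rw [← Localization.mk_eq_mk', LocalizedModule.mk_smul_mk, hr, LocalizedModule.zero_mk]
  rw [← LocalizedModule.mkLinearMap_apply, IsLocalizedModule.eq_zero_iff p.primeCompl] at h1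
  obtain ⟨c, hc⟩ := h1
  exact c.2 ((hmem c).2 hc)

/-! ### Homogeneous elements -/

/-- A monomial of degree `d` is `x ^ d` or `y ^ (-d)`, according to the sign of `d`, times a power
of `xy`. -/
lemma exists_eq_mul_aeval {d : ℤ} {p : MvPolynomial (Fin 2) ℂ}
    (hp : MvPolynomial.IsWeightedHomogeneous wt p d) :
    ∃ P : Polynomial ℂ, (Ideal.Quotient.mk _ p : R k) =
      x k ^ d.toNat * y k ^ (-d).toNat * Polynomial.aeval (x k * y k) P := by
  induction hp using MvPolynomial.IsWeightedHomogeneous.induction_on with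
  | zero => exact ⟨0, by simp⟩
  | add p q hp hq ih1 ih2 =>
    obtain ⟨P, hP⟩ := ih1
    obtain ⟨Q, hQ⟩ := ih2
    exact ⟨P + Q, by rw [map_add, map_add, mul_add, hP, hQ]⟩
  | monomial e r hr =>
    have h3 : MvPolynomial.monomial e r =
        MvPolynomial.C r * (MvPolynomial.X 0 ^ e 0 * MvPolynomial.X 1 ^ e 1) := by
      rw [MvPolynomial.monomial_eq, Finsupp.prod_fintype _ _ (by simp), Fin.prod_univ_two]
    have h4 : d = (e 0 : ℤ) - (e 1 : ℤ) := by
      rw [← hr, Finsupp.weight_apply, Finsupp.sum_fintype _ _ (by simp), Fin.sum_univ_two]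
      simp [wt, sub_eq_add_neg]
    refine ⟨Polynomial.monomial (min (e 0) (e 1)) r, ?_⟩
    have h5 : e 0 = d.toNat + min (e 0) (e 1) := by omega
    have h6 : e 1 = (-d).toNat + min (e 0) (e 1) := by omega
    have h7 : (Ideal.Quotient.mk _ (MvPolynomial.C r) : R k) = algebraMap ℂ (R k) r := rfl
    have h8 : (Ideal.Quotient.mk _ (MvPolynomial.monomial e r) : R k) =
        algebraMap ℂ (R k) r * (x k ^ e 0 * y k ^ e 1) := by
      rw [h3, map_mul, map_mul, map_pow, map_pow, h7]
      rfl
    rw [h8, Polynomial.aeval_monomial, mul_pow]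
    generalize min (e 0) (e 1) = c at h5 h6 ⊢
    rw [h5, h6, pow_add, pow_add]
    ring

/-- Since `xy` is nilpotent of degree zero, every homogeneous element of `R` is a monomial times
a unit. -/
lemma exists_eq_monomial_mul_unit {d : ℤ} {r : R k} (hr : r ∈ Rdeg k d) :
    ∃ (a b : ℕ) (u : R k), IsUnit u ∧ (a : ℤ) - b = d ∧ r = x k ^ a * y k ^ b * u := by
  obtain ⟨p, hp, rfl⟩ := hr
  obtain ⟨P, hP⟩ := exists_eq_mul_aeval (k := k) hp
  change ∃ (a b : ℕ) (u : R k), IsUnit u ∧ (a : ℤ) - b = d ∧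
    Ideal.Quotient.mk _ p = x k ^ a * y k ^ b * u
  rw [hP]
  by_cases h0 : P = 0
  -- The zero element is a monomial divisible by `x ^ k`.
  · refine ⟨k + d.toNat, k + (-d).toNat, 1, isUnit_one, by push_cast; omega, ?_⟩
    rw [h0, map_zero, x_pow_eq_zero (Nat.le_add_right _ _)]
    ring
  · obtain ⟨Q, hQ, hQ'⟩ := Polynomial.exists_eq_pow_rootMultiplicity_mul_and_not_dvd P h0 0
    rw [map_zero, sub_zero] at hQ hQ'
    rw [Polynomial.X_dvd_iff] at hQ'
    set n := P.rootMultiplicity 0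
    refine ⟨d.toNat + n, (-d).toNat + n, Polynomial.aeval (x k * y k) Q, ?_,
      by push_cast; omega, ?_⟩
    · refine Polynomial.isUnit_aeval_of_isUnit_aeval_of_isNilpotent_sub (b := 0) ?_ ?_
      · rw [← Polynomial.coeff_zero_eq_aeval_zero']
        exact (IsUnit.mk0 _ hQ').map _
      · rw [sub_zero]
        exact ((Commute.all _ _).isNilpotent_mul_right (isNilpotent_x k))
    · conv_lhs => rw [hQ]
      rw [map_mul, map_pow, Polynomial.aeval_X]
      ring

lemma y_pow_mem_Rdeg (k b : ℕ) : y k ^ b ∈ Rdeg k (-b) := by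
  simpa using SetLike.pow_mem_graded b (y_mem k)

lemma x_pow_mem_Rdeg (k a : ℕ) : x k ^ a ∈ Rdeg k a := by
  simpa using SetLike.pow_mem_graded a (x_mem k)

lemma x_pow_mul_y_pow_mem_Rdeg (k a b : ℕ) : x k ^ a * y k ^ b ∈ Rdeg k (a - b) := by
  simpa [sub_eq_add_neg] using SetLike.mul_mem_graded (x_pow_mem_Rdeg k a) (y_pow_mem_Rdeg k b)

lemma homogeneousNZD_le (k : ℕ) : homogeneousNZD k ≤ nonZeroDivisors (R k) := fun _ h => h.1

lemma y_pow_mem_homogeneousNZD (hk : k ≠ 0) (b : ℕ) : y k ^ b ∈ homogeneousNZD k :=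
  ⟨y_pow_mem_nonZeroDivisors hk b, _, y_pow_mem_Rdeg k b⟩

/-- Homogeneous non-zero-divisors are powers of `y` times units. -/
lemma exists_mul_eq_y_pow (hk : k ≠ 0) (s : homogeneousNZD k) :
    ∃ (r : R k) (b : ℕ), r * s = y k ^ b := by
  obtain ⟨s, hs, d, hd⟩ := s
  obtain ⟨a, b, u, hu, -, rfl⟩ := exists_eq_monomial_mul_unit hd
  obtain ⟨v, hv⟩ := hu.exists_right_inv
  -- For `a ≠ 0` the element would be nilpotent.
  have ha : a = 0 := by
    by_contra ha
    have := nontrivial_R hk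
    have h1 : IsNilpotent (x k ^ a * y k ^ b * u) :=
      (Commute.all _ _).isNilpotent_mul_right ((Commute.all _ _).isNilpotent_mul_right
        ((isNilpotent_x k).pow_of_pos ha))
    obtain ⟨n, hn⟩ := h1
    exact zero_notMem_nonZeroDivisors (hn ▸ pow_mem hs n)
  refine ⟨v, b, ?_⟩
  subst ha
  linear_combination y k ^ b * hv

/-! ### Localizations of modules -/

section BaseChange

variable {A : Type*} [CommRing A] {B : Type*} [CommRing B] [Algebra A B]
  {M : Type*} [AddCommGroup M] [Module A M]

lemma mul_add_eq_algebraMap {s t a b : A} {f g : B}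
    (hf : algebraMap A B s * f = algebraMap A B a) (hg : algebraMap A B t * g = algebraMap A B b) :
    algebraMap A B (s * t) * (f + g) = algebraMap A B (t * a + s * b) := by
  rw [map_add, map_mul, map_mul, map_mul, ← hf, ← hg]
  ring

lemma mul_neg_eq_algebraMap {s a : A} {f : B} (hf : algebraMap A B s * f = algebraMap A B a) :
    algebraMap A B s * (-f) = algebraMap A B (-a) := by
  rw [mul_neg, hf, map_neg]

lemma smul_add_eq_tmul {s t : A} {z w : B ⊗[A] M} {a b : M}
    (hz : algebraMap A B s • z = (1 : B) ⊗ₜ[A] a) (hw : algebraMap A B t • w = (1 : B) ⊗ₜ[A] b) :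
    algebraMap A B (s * t) • (z + w) = (1 : B) ⊗ₜ[A] (t • a + s • b) := by
  rw [TensorProduct.tmul_add, TensorProduct.tmul_smul, TensorProduct.tmul_smul, ← hz, ← hw,
    smul_add, map_mul, ← algebraMap_smul B t, ← algebraMap_smul B s, smul_smul, smul_smul,
    mul_comm (algebraMap A B t)]

lemma smul_neg_eq_tmul {s : A} {z : B ⊗[A] M} {a : M}
    (hz : algebraMap A B s • z = (1 : B) ⊗ₜ[A] a) :
    algebraMap A B s • (-z) = (1 : B) ⊗ₜ[A] (-a) := by
  rw [smul_neg, hz, TensorProduct.tmul_neg]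

lemma smul_tmul_eq_tmul {s a : A} {f : B} (hf : algebraMap A B s * f = algebraMap A B a) (m : M) :
    algebraMap A B s • (f ⊗ₜ[A] m) = (1 : B) ⊗ₜ[A] (a • m) := by
  rw [TensorProduct.smul_tmul', smul_eq_mul, hf, Algebra.algebraMap_eq_smul_one,
    TensorProduct.smul_tmul]

lemma smul_zero_eq_tmul (s : A) : algebraMap A B s • (0 : B ⊗[A] M) = (1 : B) ⊗ₜ[A] (0 : M) := by
  rw [smul_zero, TensorProduct.tmul_zero]

end BaseChange

section Localization

variable {A : Type*} [CommRing A] {S : Submonoid A} {M : Type*} [AddCommGroup M] [Module A M]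

lemma one_tmul_eq_zero_iff {m : M} :
    (1 : Localization S) ⊗ₜ[A] m = 0 ↔ ∃ s : S, (s : A) • m = 0 := by
  have : IsLocalizedModule S (TensorProduct.mk A (Localization S) M 1) :=
    (isLocalizedModule_iff_isBaseChange S (Localization S) _).2
      (TensorProduct.isBaseChange A M (Localization S))
  exact IsLocalizedModule.eq_zero_iff S (TensorProduct.mk A (Localization S) M 1)

lemma eq_zero_of_smul_eq_zero_of_basis (hS : S ≤ nonZeroDivisors A)
    (b : Module.Basis (Fin 1) (Localization S) (Localization S ⊗[A] M)) {s : S} {g : M}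
    (h : algebraMap A (Localization S) s • b 0 = (1 : Localization S) ⊗ₜ[A] g) {r : A}
    (hr : r • g = 0) : r = 0 := by
  have h1 : (algebraMap A (Localization S) (r * s)) • b 0 = 0 := by
    rw [map_mul, mul_smul, h, algebraMap_smul, ← TensorProduct.tmul_smul, hr,
      TensorProduct.tmul_zero]
  have h2 : algebraMap A (Localization S) (r * s) = 0 := by
    simpa using congrArg (fun z => b.repr z 0) h1
  rw [IsLocalization.map_eq_zero_iff S] at h2
  obtain ⟨c, hc⟩ := h2
  exact mem_nonZeroDivisors_iff_right.1 (hS s.2) _ (mem_nonZeroDivisors_iff_left.1 (hS c.2) _ hc)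

lemma exists_smul_eq_smul_of_basis
    (b : Module.Basis (Fin 1) (Localization S) (Localization S ⊗[A] M)) {s : S} {g : M}
    (h : algebraMap A (Localization S) s • b 0 = (1 : Localization S) ⊗ₜ[A] g) (m : M) :
    ∃ (t : S) (a : A), (t : A) • m = a • g := by
  obtain ⟨f, hf⟩ : ∃ f : Localization S, (1 : Localization S) ⊗ₜ[A] m = f • b 0 :=
    ⟨b.repr ((1 : Localization S) ⊗ₜ[A] m) 0, by
      conv_lhs => rw [← b.sum_repr ((1 : Localization S) ⊗ₜ[A] m), Fin.sum_univ_one]⟩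
  obtain ⟨⟨a, t⟩, hat⟩ := IsLocalization.surj S f
  have h1 : (1 : Localization S) ⊗ₜ[A] (((s : A) * t) • m - a • g) = 0 := by
    rw [TensorProduct.tmul_sub, TensorProduct.tmul_smul, TensorProduct.tmul_smul, hf, ← h,
      ← algebraMap_smul (Localization S) ((s : A) * t), ← algebraMap_smul (Localization S) a,
      ← hat, smul_smul, smul_smul, map_mul, sub_eq_zero]
    congr 1
    ring
  obtain ⟨c, hc⟩ := one_tmul_eq_zero_iff.1 h1
  refine ⟨c * (s * t), c * a, ?_⟩
  rw [smul_sub, sub_eq_zero, smul_smul, smul_smul] at hc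
  exact hc

lemma exists_basis_of_smul_eq_smul (hS : S ≤ nonZeroDivisors A) {g : M}
    (hinj : ∀ r : A, r • g = 0 → r = 0) (hgen : ∀ m : M, ∃ (t : S) (a : A), (t : A) • m = a • g) :
    ∃ b : Module.Basis (Fin 1) (Localization S) (Localization S ⊗[A] M),
      ∀ t, b t = (1 : Localization S) ⊗ₜ[A] g := by
  have hli : LinearIndependent (Localization S) fun _ : Fin 1 => (1 : Localization S) ⊗ₜ[A] g := by
    rw [Fintype.linearIndependent_iff]
    intro f hf i
    rw [Fin.sum_univ_one] at hf
    obtain ⟨⟨a, t⟩, hat⟩ := IsLocalization.surj S (f 0)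
    have h1 : (1 : Localization S) ⊗ₜ[A] (a • g) = 0 := by
      rw [TensorProduct.tmul_smul, ← algebraMap_smul (Localization S) a, ← hat, mul_comm (f 0),
        mul_smul, hf, smul_zero]
    obtain ⟨c, hc⟩ := one_tmul_eq_zero_iff.1 h1
    rw [smul_smul] at hc
    have h2 : a = 0 := mem_nonZeroDivisors_iff_left.1 (hS c.2) _ (hinj _ hc)
    rw [h2, map_zero] at hat
    rw [Subsingleton.elim i 0]
    exact (IsLocalization.map_units (Localization S) t).mul_left_eq_zero.1 hat
  have hsp : ⊤ ≤ Submodule.span (Localization S)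
      (Set.range fun _ : Fin 1 => (1 : Localization S) ⊗ₜ[A] g) := by
    rintro z -
    induction z using TensorProduct.induction_on with
    | zero => exact Submodule.zero_mem _
    | add z w hz hw => exact Submodule.add_mem _ hz hw
    | tmul f m =>
      obtain ⟨t, a, h⟩ := hgen m
      obtain ⟨v, hv⟩ := (IsLocalization.map_units (Localization S) t).exists_left_inv
      have h1 : f ⊗ₜ[A] m =
          (f * v * algebraMap A (Localization S) a) • ((1 : Localization S) ⊗ₜ[A] g) := by
        rw [mul_smul, algebraMap_smul, ← TensorProduct.tmul_smul, ← h, TensorProduct.tmul_smul,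
          ← algebraMap_smul (Localization S) (t : A), smul_smul, mul_assoc, hv,
          TensorProduct.smul_tmul']
        simp
      rw [h1]
      exact Submodule.smul_mem _ _ (Submodule.subset_span ⟨0, rfl⟩)
  exact ⟨Module.Basis.mk hli hsp, fun t => by rw [Module.Basis.mk_apply]⟩

end Localization

/-! ### Generic freeness -/

lemma exists_mul_eq_algebraMap_of_mem_Fdeg {d : ℤ} {f : F k} (hf : f ∈ Fdeg k d) :
    ∃ (s : homogeneousNZD k) (j : ℤ) (a : R k), (s : R k) ∈ Rdeg k j ∧ a ∈ Rdeg k (j + d) ∧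
      algebraMap (R k) (F k) s * f = algebraMap (R k) (F k) a := by
  induction hf using AddSubgroup.closure_induction with
  | mem z hz =>
    obtain ⟨i, j, a, s, ha, hs, rfl, rfl⟩ := hz
    refine ⟨s, j, a, hs, by rwa [add_sub_cancel], ?_⟩
    rw [Localization.mk_eq_mk']
    exact IsLocalization.mk'_spec' (F k) a s
  | zero =>
    exact ⟨1, 0, 0, SetLike.GradedOne.one_mem, Submodule.zero_mem _,
      (mul_zero _).trans (map_zero _).symm⟩
  | add f g _ _ ihf ihg =>
    obtain ⟨s, j, a, hs, ha, h⟩ := ihf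
    obtain ⟨s', j', a', hs', ha', h'⟩ := ihg
    refine ⟨s * s', j + j', s' * a + s * a', SetLike.mul_mem_graded hs hs',
      Submodule.add_mem _ ?_ ?_, mul_add_eq_algebraMap (A := R k) (B := F k) h h'⟩
    · convert SetLike.mul_mem_graded hs' ha using 2; ring
    · convert SetLike.mul_mem_graded hs ha' using 2; ring
  | neg f _ ih =>
    obtain ⟨s, j, a, hs, ha, h⟩ := ih
    exact ⟨s, j, -a, hs, Submodule.neg_mem _ ha, mul_neg_eq_algebraMap (A := R k) (B := F k) h⟩

/-- A homogeneous element of `F ⊗ M` has a homogeneous denominator. -/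
lemma exists_smul_eq_tmul_of_mem_genericDeg (M : GrMod.{u} k) {d : ℤ}
    {z : F k ⊗[R k] M.carrier} (hz : z ∈ M.genericDeg d) :
    ∃ (s : homogeneousNZD k) (j : ℤ) (m : M.carrier), (s : R k) ∈ Rdeg k j ∧ m ∈ M.deg (j + d) ∧
      algebraMap (R k) (F k) s • z = (1 : F k) ⊗ₜ[R k] m := by
  induction hz using AddSubgroup.closure_induction with
  | mem z hz =>
    obtain ⟨i, j, f, m, hf, hm, rfl, rfl⟩ := hz
    obtain ⟨s, l, a, hs, ha, h⟩ := exists_mul_eq_algebraMap_of_mem_Fdeg hf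
    exact ⟨s, l, a • m, hs, by rw [← add_assoc]; exact M.smul_mem ha hm,
      smul_tmul_eq_tmul (A := R k) (B := F k) h m⟩
  | zero =>
    exact ⟨1, 0, 0, SetLike.GradedOne.one_mem, zero_mem _,
      smul_zero_eq_tmul (A := R k) (B := F k) _⟩
  | add f g _ _ ihf ihg =>
    obtain ⟨s, j, a, hs, ha, h⟩ := ihf
    obtain ⟨s', j', a', hs', ha', h'⟩ := ihg
    refine ⟨s * s', j + j', (s' : R k) • a + (s : R k) • a', SetLike.mul_mem_graded hs hs',
      add_mem ?_ ?_, smul_add_eq_tmul (A := R k) (B := F k) h h'⟩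
    · convert M.smul_mem hs' ha using 2; ring
    · convert M.smul_mem hs ha' using 2; ring
  | neg f _ ih =>
    obtain ⟨s, j, a, hs, ha, h⟩ := ih
    exact ⟨s, j, -a, hs, neg_mem ha, smul_neg_eq_tmul (A := R k) (B := F k) h⟩

/-- The graded fraction ring inverts just `y` up to units, so a graded module is generically free
of rank one iff it contains a homogeneous element with zero annihilator that generates it up to
powers of `y`. -/
lemma isGenericallyFree_one_iff (hk : k ≠ 0) (M : GrMod.{u} k) :
    M.IsGenericallyFree 1 ↔ ∃ (e : ℤ) (g : M.carrier), g ∈ M.deg e ∧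
      (∀ r : R k, r • g = 0 → r = 0) ∧ ∀ m : M.carrier, ∃ (n : ℕ) (a : R k),
        y k ^ n • m = a • g := by
  constructor
  · rintro ⟨b, hb⟩
    obtain ⟨d, hd⟩ := hb 0
    obtain ⟨s, j, g, hs, hg, h⟩ := exists_smul_eq_tmul_of_mem_genericDeg M hd
    refine ⟨j + d, g, hg, fun r hr => ?_, fun m => ?_⟩
    · exact eq_zero_of_smul_eq_zero_of_basis (A := R k) (S := homogeneousNZD k)
        (homogeneousNZD_le k) b h hr
    · obtain ⟨t, a, ht⟩ :=
        exists_smul_eq_smul_of_basis (A := R k) (S := homogeneousNZD k) b h m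
      obtain ⟨r, n, hr⟩ := exists_mul_eq_y_pow hk t
      exact ⟨n, r * a, by rw [← hr, mul_smul, ht, mul_smul]⟩
  · rintro ⟨e, g, hg, hinj, hgen⟩
    have hgen' : ∀ m : M.carrier, ∃ (t : homogeneousNZD k) (a : R k), (t : R k) • m = a • g :=
      fun m => by
        obtain ⟨n, a, h⟩ := hgen m
        exact ⟨⟨_, y_pow_mem_homogeneousNZD hk n⟩, a, h⟩
    obtain ⟨b, hb⟩ := exists_basis_of_smul_eq_smul (A := R k) (S := homogeneousNZD k)
      (homogeneousNZD_le k) hinj hgen'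
    exact ⟨b, fun t => ⟨0 + e, AddSubgroup.subset_closure
      ⟨0, e, 1, g, AddSubgroup.subset_closure ⟨0, 0, 1, 1, SetLike.GradedOne.one_mem,
        SetLike.GradedOne.one_mem, sub_zero 0, Localization.mk_one.symm⟩, hg, rfl, hb t⟩⟩⟩

lemma GrMod.Iso.isGenericallyFree_one (hk : k ≠ 0) {M : GrMod.{u} k} {N : GrMod.{v} k}
    (h : M.Iso N) (hN : N.IsGenericallyFree 1) : M.IsGenericallyFree 1 := by
  obtain ⟨φ, hφ⟩ := h
  obtain ⟨e, g, hg, hinj, hgen⟩ := (isGenericallyFree_one_iff hk N).1 hN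
  refine (isGenericallyFree_one_iff hk M).2 ⟨e, φ.symm g, ?_, fun r hr => hinj r ?_, fun m => ?_⟩
  · rwa [← hφ, φ.apply_symm_apply]
  · simpa using congrArg φ hr
  · obtain ⟨n, a, h⟩ := hgen (φ m)
    exact ⟨n, a, φ.injective (by simpa using h)⟩

/-! ### Staircase ideals -/

/-- The monomial ideal of `R` generated by the `x ^ a * y ^ j a` for `a < k`. -/
def stairIdeal (k : ℕ) (j : ℕ → ℕ) : Ideal (R k) :=
  Ideal.span (Set.range fun a : Fin k => x k ^ (a : ℕ) * y k ^ j a)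

lemma x_pow_mul_y_pow_mem_stairIdeal {j : ℕ → ℕ} {a b : ℕ} (h : k ≤ a ∨ j a ≤ b) :
    x k ^ a * y k ^ b ∈ stairIdeal k j := by
  by_cases ha : k ≤ a
  · rw [x_pow_eq_zero ha, zero_mul]
    exact zero_mem _
  · have hb : j a ≤ b := h.resolve_left ha
    obtain ⟨c, rfl⟩ := Nat.exists_eq_add_of_le hb
    rw [pow_add, ← mul_assoc]
    exact Ideal.mul_mem_right _ _ (Ideal.subset_span ⟨⟨a, by omega⟩, rfl⟩)

/-- Membership of monomials is decided in the polynomial ring, where the preimage of the ideal is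
the monomial ideal generated by `x ^ k` and the listed monomials. -/
lemma x_pow_mul_y_pow_mem_stairIdeal_iff {j : ℕ → ℕ} (hj : Antitone j) {a b : ℕ} :
    x k ^ a * y k ^ b ∈ stairIdeal k j ↔ k ≤ a ∨ j a ≤ b := by
  refine ⟨fun h => ?_, x_pow_mul_y_pow_mem_stairIdeal⟩
  let mon : ℕ → ℕ → (Fin 2 →₀ ℕ) := fun a b => Finsupp.single 0 a + Finsupp.single 1 b
  have hmon : ∀ a b : ℕ, MvPolynomial.monomial (mon a b) (1 : ℂ) =
      MvPolynomial.X 0 ^ a * MvPolynomial.X 1 ^ b := fun a b => by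
    rw [MvPolynomial.X_pow_eq_monomial, MvPolynomial.X_pow_eq_monomial,
      MvPolynomial.monomial_mul, one_mul]
  have hmk : ∀ a b : ℕ, (Ideal.Quotient.mk _ (MvPolynomial.monomial (mon a b) (1 : ℂ)) : R k) =
      x k ^ a * y k ^ b := fun a b => by
    rw [hmon, map_mul, map_pow, map_pow]
    rfl
  let T : Set (Fin 2 →₀ ℕ) := Set.range fun a : Fin k => mon a (j a)
  have h1 : stairIdeal k j = (Ideal.span ((fun s => MvPolynomial.monomial s (1 : ℂ)) '' T)).map
      (Ideal.Quotient.mk (Ideal.span {(MvPolynomial.X 0) ^ k})) := by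
    rw [Ideal.map_span, stairIdeal]
    congr 1
    ext r
    simp only [T, Set.mem_range, Set.mem_image, exists_exists_eq_and, hmk]
  rw [← hmk, h1, ← Ideal.mem_comap, Ideal.comap_map_quotientMk] at h
  have h2 : (Ideal.span {(MvPolynomial.X 0) ^ k} : Ideal (MvPolynomial (Fin 2) ℂ)) ⊔
      Ideal.span ((fun s => MvPolynomial.monomial s (1 : ℂ)) '' T) =
      Ideal.span ((fun s => MvPolynomial.monomial s (1 : ℂ)) '' (insert (mon k 0) T)) := by
    rw [Set.image_insert_eq, hmon, pow_zero, mul_one, Ideal.span_insert]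
  rw [h2, MvPolynomial.mem_ideal_span_monomial_image] at h
  obtain ⟨s, hs, hs'⟩ := h (mon a b) (by simp [MvPolynomial.support_monomial])
  have hs0 := hs' 0
  have hs1 := hs' 1
  rcases hs with rfl | ⟨c, rfl⟩
  · left
    simpa [mon] using hs0
  · right
    have h3 : (c : ℕ) ≤ a := by simpa [mon] using hs0
    have h4 : j c ≤ b := by simpa [mon] using hs1
    exact (hj h3).trans h4

/-- A homogeneous ideal containing a power of `y` is a staircase ideal, because each homogeneous
element is a monomial times a unit. -/
lemma exists_eq_stairIdeal {I : Ideal (R k)} (hI : I.IsHomogeneous (Rdeg k)) {N : ℕ}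
    (hN : y k ^ N ∈ I) : ∃ j : ℕ → ℕ, Antitone j ∧ I = stairIdeal k j := by
  classical
  have hne : ∀ a : ℕ, ∃ b : ℕ, x k ^ a * y k ^ b ∈ I := fun a => ⟨N, Ideal.mul_mem_left _ _ hN⟩
  refine ⟨fun a => Nat.find (hne a), antitone_nat_of_succ_le fun a => ?_, le_antisymm ?_ ?_⟩
  · refine Nat.find_min' _ ?_
    rw [pow_succ', mul_assoc]
    exact Ideal.mul_mem_left _ _ (Nat.find_spec (hne a))
  · intro r hr
    rw [← DirectSum.sum_support_decompose (Rdeg k) r]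
    refine Ideal.sum_mem _ fun d _ => ?_
    have h1 := hI d hr
    obtain ⟨a, b, u, hu, -, h2⟩ :=
      exists_eq_monomial_mul_unit (SetLike.coe_mem (DirectSum.decompose (Rdeg k) r d))
    rw [h2] at h1 ⊢
    rw [Ideal.mul_unit_mem_iff_mem _ hu] at h1
    exact Ideal.mul_mem_right _ _
      (x_pow_mul_y_pow_mem_stairIdeal (Or.inr (Nat.find_min' _ h1)))
  · rw [stairIdeal, Ideal.span_le]
    rintro _ ⟨a, rfl⟩
    exact Nat.find_spec (hne a)

/-- The exponent of `y` attached to `x ^ a` in the ideal with exponents `i`. -/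
def stair (i : Fin (k - 1) →o ℕ) (a : ℕ) : ℕ :=
  if h : a < k - 1 then i ⟨k - 2 - a, by omega⟩ else 0

lemma stair_of_lt (i : Fin (k - 1) →o ℕ) {a : ℕ} (h : a < k - 1) :
    stair i a = i ⟨k - 2 - a, by omega⟩ := dif_pos h

lemma stair_of_le (i : Fin (k - 1) →o ℕ) {a : ℕ} (h : k - 1 ≤ a) : stair i a = 0 :=
  dif_neg (by omega)

lemma stair_antitone (i : Fin (k - 1) →o ℕ) : Antitone (stair i) := by
  intro a b hab
  by_cases hb : b < k - 1
  · rw [stair_of_lt i hb, stair_of_lt i (hab.trans_lt hb)]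
    exact i.monotone (Fin.mk_le_mk.2 (by omega))
  · rw [stair_of_le i (by omega)]
    exact Nat.zero_le _

lemma span_monomialGens (hk : k ≠ 0) (i : Fin (k - 1) →o ℕ) :
    Ideal.span (monomialGens i) = stairIdeal k (stair i) := by
  rw [stairIdeal]
  congr 1
  apply Set.Subset.antisymm
  · rintro _ (rfl | ⟨p, rfl⟩)
    · exact ⟨⟨k - 1, by omega⟩, by simp [stair_of_le]⟩
    · have hp := p.2
      refine ⟨⟨k - 2 - p, by omega⟩, ?_⟩
      dsimp only
      rw [stair_of_lt i (by omega)]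
      congr 3
      apply Fin.ext
      dsimp only
      omega
  · rintro _ ⟨⟨a, ha⟩, rfl⟩
    dsimp only
    by_cases h : a < k - 1
    · right
      refine ⟨⟨k - 2 - a, by omega⟩, ?_⟩
      rw [stair_of_lt i h]
      dsimp only
      congr 2
      omega
    · left
      rw [stair_of_le i (by omega), pow_zero, mul_one, show a = k - 1 by omega]
      rfl

/-! ### Isomorphisms of graded modules -/

lemma GrMod.Iso.trans {M : GrMod.{u} k} {N : GrMod.{v} k} {P : GrMod.{v} k} (h : M.Iso N)
    (h' : N.Iso P) : M.Iso P := by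
  obtain ⟨e, he⟩ := h
  obtain ⟨f, hf⟩ := h'
  exact ⟨e.trans f, fun d m => by rw [LinearEquiv.trans_apply, hf, he]⟩

/-- An injective map between graded groups that preserves degrees also reflects them. -/
lemma mem_of_map_mem {M : Type u} {N : Type v} [AddCommGroup M] [AddCommGroup N]
    {A : ℤ → AddSubgroup M} {B : ℤ → AddSubgroup N} (hA : DirectSum.IsInternal A)
    (hB : DirectSum.IsInternal B) {f : M →+ N} (hf : Function.Injective f)
    (hAB : ∀ d, ∀ m ∈ A d, f m ∈ B d) {d : ℤ} {m : M} (hm : f m ∈ B d) : m ∈ A d := by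
  classical
  let _ := hA.chooseDecomposition
  let _ := hB.chooseDecomposition
  have h : ∀ m : M, f (DirectSum.decompose A m d) = DirectSum.decompose B (f m) d := by
    intro m
    induction m using DirectSum.Decomposition.inductionOn A with
    | zero => simp
    | @homogeneous i m =>
      by_cases hi : i = d
      · subst hi
        rw [DirectSum.decompose_of_mem_same A m.2, DirectSum.decompose_of_mem_same B (hAB _ _ m.2)]
      · rw [DirectSum.decompose_of_mem_ne A m.2 hi,
          DirectSum.decompose_of_mem_ne B (hAB _ _ m.2) hi, map_zero]
    | add m m' h h' => simp [DirectSum.decompose_add, h, h']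
  have h1 : f (DirectSum.decompose A m d) = f m := by
    rw [h, DirectSum.decompose_of_mem_same B hm]
  rw [← hf h1]
  exact SetLike.coe_mem _

lemma Rdeg_isInternal (k : ℕ) : DirectSum.IsInternal fun d => (Rdeg k d).toAddSubgroup :=
  DirectSum.Decomposition.isInternal (Rdeg k)

/-- The ring `R` as a graded module over itself. -/
def GrMod.self (k : ℕ) : GrMod.{0} k where
  carrier := R k
  deg d := (Rdeg k d).toAddSubgroup
  isInternal := Rdeg_isInternal k
  smul_mem := fun hr hm => SetLike.mul_mem_graded hr hm

lemma mulLeft_y_pow_injective (hk : k ≠ 0) (c : ℕ) :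
    Function.Injective (LinearMap.mulLeft (R k) (y k ^ c)) := by
  intro a b hab
  have hab' : y k ^ c * a = y k ^ c * b := hab
  rw [← sub_eq_zero, ← mul_sub] at hab'
  exact sub_eq_zero.1 (mem_nonZeroDivisors_iff_left.1 (y_pow_mem_nonZeroDivisors hk c) _ hab')

lemma y_pow_mul_mem_Rdeg_iff (hk : k ≠ 0) (c : ℕ) {d : ℤ} {r : R k} :
    y k ^ c * r ∈ Rdeg k (-c + d) ↔ r ∈ Rdeg k d := by
  refine ⟨fun h => ?_, fun h => SetLike.mul_mem_graded (y_pow_mem_Rdeg k c) h⟩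
  refine mem_of_map_mem (Rdeg_isInternal k) ((GrMod.self k).shift (-c)).isInternal
    (f := AddMonoidHom.mulLeft (y k ^ c)) (fun a b hab => ?_) (fun d m hm => ?_) (d := d) ?_
  · exact mulLeft_y_pow_injective hk c hab
  · change y k ^ c * m ∈ Rdeg k (d + -c)
    rw [add_comm]
    exact SetLike.mul_mem_graded (y_pow_mem_Rdeg k c) hm
  · change y k ^ c * r ∈ Rdeg k (d + -c)
    rwa [add_comm]

lemma iso_of_eq_map_mulLeft (hk : k ≠ 0) {I J : Ideal (R k)} (hI : I.IsHomogeneous (Rdeg k))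
    (hJ : J.IsHomogeneous (Rdeg k)) {c : ℕ}
    (h : I = Submodule.map (LinearMap.mulLeft (R k) (y k ^ c)) J) (n : ℤ) :
    ((GrMod.ofIdeal I hI).shift n).Iso ((GrMod.ofIdeal J hJ).shift (n + c)) := by
  subst h
  let e := Submodule.equivMapOfInjective _ (mulLeft_y_pow_injective hk c) J
  have he : ∀ (d : ℤ) (m : Submodule.map (LinearMap.mulLeft (R k) (y k ^ c)) J),
      ((e.symm m : J) : R k) ∈ Rdeg k (d + (n + c)) ↔ (m : R k) ∈ Rdeg k (d + n) := by
    intro d m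
    obtain ⟨a, rfl⟩ := e.surjective m
    rw [e.symm_apply_apply]
    change (a : R k) ∈ Rdeg k (d + (n + c)) ↔ y k ^ c * (a : R k) ∈ Rdeg k (d + n)
    rw [← y_pow_mul_mem_Rdeg_iff hk c]
    ring_nf
  exact ⟨e.symm, he⟩

/-- A homogeneous ideal containing a power of `y` is a shifted monomial module: divide the
generators of the staircase ideal by the least power of `y`. -/
lemma exists_iso_monomialModule (hk : k ≠ 0) {I : Ideal (R k)} (hI : I.IsHomogeneous (Rdeg k))
    {N : ℕ} (hN : y k ^ N ∈ I) (n : ℤ) :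
    ∃ (i : Fin (k - 1) →o ℕ) (n' : ℤ),
      ((GrMod.ofIdeal I hI).shift n).Iso (monomialModule i n') := by
  obtain ⟨j, hj, hIj⟩ := exists_eq_stairIdeal hI hN
  let i : Fin (k - 1) →o ℕ :=
    ⟨fun p => j (k - 2 - p) - j (k - 1), fun p q hpq => Nat.sub_le_sub_right (hj (by
      have : (p : ℕ) ≤ q := hpq
      omega)) _⟩
  have hi : ∀ a < k, j a = j (k - 1) + stair i a := by
    intro a ha
    by_cases h : a < k - 1
    · rw [stair_of_lt i h]
      change j a = j (k - 1) + (j (k - 2 - (k - 2 - a)) - j (k - 1))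
      rw [show k - 2 - (k - 2 - a) = a by omega]
      have := hj h.le
      omega
    · rw [stair_of_le i (by omega), show a = k - 1 by omega, add_zero]
  refine ⟨i, _, iso_of_eq_map_mulLeft hk hI (monomialIdeal_isHomogeneous i) (c := j (k - 1)) ?_ n⟩
  rw [hIj, span_monomialGens hk]
  refine Eq.trans ?_ (Submodule.map_span _ _).symm
  change Submodule.span (R k) _ = _
  congr 1
  ext r
  constructor
  · rintro ⟨a, rfl⟩
    refine ⟨_, ⟨a, rfl⟩, ?_⟩
    rw [LinearMap.mulLeft_apply]
    dsimp only
    rw [hi a a.2, pow_add]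
    ring
  · rintro ⟨_, ⟨a, rfl⟩, rfl⟩
    refine ⟨a, ?_⟩
    rw [LinearMap.mulLeft_apply]
    dsimp only
    rw [hi a a.2, pow_add]
    ring

/-! ### Embedding a rank one module in `R` -/

/-- For a finitely generated module the power of `y` can be chosen uniformly. -/
lemma exists_y_pow_smul_eq_smul {M : Type u} [AddCommGroup M] [Module (R k) M]
    [Module.Finite (R k) M] {g : M} (h : ∀ m : M, ∃ (n : ℕ) (a : R k), y k ^ n • m = a • g) :
    ∃ N : ℕ, ∀ m : M, ∃ a : R k, y k ^ N • m = a • g := by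
  obtain ⟨s, hs⟩ := Module.Finite.fg_top (R := R k) (M := M)
  choose n a ha using h
  refine ⟨s.sup n, fun m => ?_⟩
  have hm : m ∈ Submodule.span (R k) (s : Set M) := hs ▸ Submodule.mem_top
  induction hm using Submodule.span_induction with
  | mem m hm =>
    obtain ⟨c, hc⟩ := Nat.exists_eq_add_of_le (Finset.le_sup (f := n) hm)
    exact ⟨y k ^ c * a m, by rw [hc, add_comm, pow_add, mul_smul, ha, mul_smul]⟩
  | zero => exact ⟨(0 : R k), (smul_zero _).trans (zero_smul (R k) g).symm⟩
  | add m m' _ _ h h' =>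
    obtain ⟨b, hb⟩ := h
    obtain ⟨b', hb'⟩ := h'
    exact ⟨b + b', by rw [smul_add, hb, hb', add_smul]⟩
  | smul r m _ h =>
    obtain ⟨b, hb⟩ := h
    exact ⟨r * b, by rw [smul_comm, hb, mul_smul]⟩

/-- If `g` generates `M` up to powers of `y`, then `y ^ N • m = φ m • g` defines an embedding `φ`
of `M` in `R` for a large `N`; its image is a homogeneous ideal containing `y ^ N = φ g`. -/
lemma exists_iso_ofIdeal (M : GrMod.{u} k) [Module.Finite (R k) M.carrier]
    (hy : ∀ m : M.carrier, y k • m = 0 → m = 0) {e : ℤ} {g : M.carrier} (hg : g ∈ M.deg e)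
    (hinj : ∀ r : R k, r • g = 0 → r = 0)
    (hgen : ∀ m : M.carrier, ∃ (n : ℕ) (a : R k), y k ^ n • m = a • g) :
    ∃ (I : Ideal (R k)) (hI : I.IsHomogeneous (Rdeg k)) (N : ℕ) (n : ℤ), y k ^ N ∈ I ∧
      M.Iso ((GrMod.ofIdeal I hI).shift n) := by
  obtain ⟨N, hN⟩ := exists_y_pow_smul_eq_smul hgen
  have hyN : ∀ (N : ℕ) (m : M.carrier), y k ^ N • m = 0 → m = 0 := by
    intro N
    induction N with
    | zero => exact fun m hm => by simpa using hm
    | succ N ih => exact fun m hm => hy m (ih _ (by rwa [← mul_smul, ← pow_succ]))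
  have huniq : ∀ a b : R k, a • g = b • g → a = b := fun a b hab =>
    sub_eq_zero.1 (hinj _ (by rw [sub_smul, hab, sub_self]))
  choose f hf using hN
  let φ : M.carrier →ₗ[R k] R k :=
    { toFun := f
      map_add' := fun m m' => huniq _ _ (by rw [← hf, smul_add, hf, hf, add_smul])
      map_smul' := fun r m => huniq _ _ (by
        rw [← hf, smul_comm, hf, RingHom.id_apply, smul_eq_mul, mul_smul]) }
  have hφ : ∀ m, y k ^ N • m = φ m • g := hf
  have hφinj : Function.Injective φ := by
    rw [injective_iff_map_eq_zero]
    exact fun m hm => hyN N m ((hφ m).trans (hm ▸ zero_smul (R k) g))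
  have hφg : φ g = y k ^ N := huniq _ _ (hφ g).symm
  have hdeg : ∀ d m, φ m ∈ Rdeg k (d + (-N - e)) ↔ m ∈ M.deg d := by
    intro d m
    constructor
    · intro hm
      refine mem_of_map_mem M.isInternal (M.shift (-N)).isInternal
        (f := (LinearMap.lsmul (R k) M.carrier (y k ^ N)).toAddMonoidHom)
        ((injective_iff_map_eq_zero _).2 (hyN N)) (fun d m hm => ?_) ?_
      · change y k ^ N • m ∈ M.deg (d + -N)
        rw [add_comm]
        exact M.smul_mem (y_pow_mem_Rdeg k N) hm
      · change y k ^ N • m ∈ M.deg (d + -N)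
        rw [hφ]
        convert M.smul_mem hm hg using 2
        ring
    · intro hm
      refine mem_of_map_mem (Rdeg_isInternal k) (M.shift e).isInternal
        (f := (LinearMap.toSpanSingleton (R k) M.carrier g).toAddMonoidHom)
        ((injective_iff_map_eq_zero _).2 hinj) (fun d m hm => M.smul_mem hm hg) ?_
      change φ m • g ∈ M.deg (d + (-N - e) + e)
      rw [← hφ]
      convert M.smul_mem (y_pow_mem_Rdeg k N) hm using 2
      ring
  have hI : (LinearMap.range φ : Ideal (R k)).IsHomogeneous (Rdeg k) := by
    rintro i _ ⟨m, rfl⟩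
    have hm : m ∈ iSup M.deg := iSup_of_isInternal M.isInternal ▸ AddSubgroup.mem_top m
    induction hm using AddSubgroup.iSup_induction' with
    | hp d m hm =>
      have h := (hdeg d m).2 hm
      by_cases hi : d + (-N - e) = i
      · subst hi
        rw [DirectSum.decompose_of_mem_same _ h]
        exact ⟨m, rfl⟩
      · rw [DirectSum.decompose_of_mem_ne _ h hi]
        exact zero_mem _
    | h1 =>
      rw [map_zero, DirectSum.decompose_zero]
      exact zero_mem _
    | hadd m m' _ _ h h' =>
      rw [map_add, DirectSum.decompose_add]
      exact add_mem h h'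
  exact ⟨LinearMap.range φ, hI, N, -N - e, ⟨g, hφg⟩, LinearEquiv.ofInjective φ hφinj,
    fun d m => hdeg d m⟩

/-! ### The monomial modules -/

lemma y_pow_mem_span_monomialGens (hk : k ≠ 0) (i : Fin (k - 1) →o ℕ) :
    y k ^ stair i 0 ∈ Ideal.span (monomialGens i) := by
  have h := x_pow_mul_y_pow_mem_stairIdeal (k := k) (j := stair i) (a := 0) (Or.inr le_rfl)
  rwa [pow_zero, one_mul, ← span_monomialGens hk] at h

lemma monomialModule_isMCM (hk : k ≠ 0) (i : Fin (k - 1) →o ℕ) (n : ℤ) :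
    (monomialModule i n).IsMCM :=
  isMaximalCohenMacaulay_ideal hk _ (y_pow_mem_span_monomialGens hk i)
    (y_pow_mem_nonZeroDivisors hk _)

lemma monomialModule_isGenericallyFree (hk : k ≠ 0) (i : Fin (k - 1) →o ℕ) (n : ℤ) :
    (monomialModule i n).IsGenericallyFree 1 := by
  refine (isGenericallyFree_one_iff hk _).2
    ⟨-stair i 0 - n, (⟨_, y_pow_mem_span_monomialGens hk i⟩ : Ideal.span (monomialGens i)),
      ?_, fun r hr => ?_, fun m => ⟨stair i 0, m.1, Subtype.ext (mul_comm _ _)⟩⟩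
  · change y k ^ stair i 0 ∈ Rdeg k (-stair i 0 - n + n)
    rw [sub_add_cancel]
    exact y_pow_mem_Rdeg k _
  · have h : r * y k ^ stair i 0 = 0 := congrArg Subtype.val hr
    exact mem_nonZeroDivisors_iff_right.1 (y_pow_mem_nonZeroDivisors hk _) _ h

/-- A rank one module is isomorphic to a monomial module. -/
lemma exists_iso_monomialModule_of_isGenericallyFree (hk : k ≠ 0) {M : GrMod.{u} k}
    (hM : M.IsMCM) (h : M.IsGenericallyFree 1) :
    ∃ (i : Fin (k - 1) →o ℕ) (n : ℤ), M.Iso (monomialModule i n) := by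
  obtain ⟨e, g, hg, hinj, hgen⟩ := (isGenericallyFree_one_iff hk M).1 h
  have := hM.1
  obtain ⟨I, hI, N, n, hN, hiso⟩ :=
    exists_iso_ofIdeal M (fun m hm => y_smul_injective hk hM hm) hg hinj hgen
  obtain ⟨i, n', hiso'⟩ := exists_iso_monomialModule hk hI hN n
  exact ⟨i, n', hiso.trans hiso'⟩

/-- The degree of the generator `x ^ a * y ^ stair i a` is recovered from the graded module: it is
the largest degree in which `(xy) ^ (k - 1 - a)` acts as a nonzero map. -/
lemma xy_pow_smul_eq_zero_iff (i : Fin (k - 1) →o ℕ) (n d : ℤ) {a : ℕ} (ha : a < k) :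
    (∀ m ∈ (monomialModule i n).deg d, (x k * y k) ^ (k - 1 - a) • m = 0) ↔
      (a : ℤ) - stair i a - n < d := by
  have hk : k ≠ 0 := by omega
  constructor
  · intro h
    by_contra hd
    obtain ⟨b, hb⟩ := Int.eq_ofNat_of_zero_le (show 0 ≤ (a : ℤ) - n - d by omega)
    have hmem : x k ^ a * y k ^ b ∈ Ideal.span (monomialGens i) := by
      rw [span_monomialGens hk]
      exact x_pow_mul_y_pow_mem_stairIdeal (Or.inr (by omega))
    have h1 := h (⟨_, hmem⟩ : Ideal.span (monomialGens i)) (by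
      change x k ^ a * y k ^ b ∈ Rdeg k (d + n)
      convert x_pow_mul_y_pow_mem_Rdeg k a b using 2
      omega)
    have h2 : (x k * y k) ^ (k - 1 - a) * (x k ^ a * y k ^ b) = 0 := congrArg Subtype.val h1
    have h3 : (x k * y k) ^ (k - 1 - a) * (x k ^ a * y k ^ b) =
        x k ^ (k - 1 - a + a) * y k ^ (k - 1 - a + b) := by ring
    rw [h3] at h2
    exact x_pow_mul_y_pow_ne_zero (by omega) _ h2
  · intro hd m hm
    apply Subtype.ext
    obtain ⟨m, hmI⟩ := m
    change (x k * y k) ^ (k - 1 - a) * m = 0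
    have hm' : m ∈ Rdeg k (d + n) := hm
    obtain ⟨c, b, u, hu, hcb, rfl⟩ := exists_eq_monomial_mul_unit hm'
    rw [span_monomialGens hk, Ideal.mul_unit_mem_iff_mem _ hu,
      x_pow_mul_y_pow_mem_stairIdeal_iff (stair_antitone i)] at hmI
    -- A monomial of degree `d + n` in the ideal has an `x`-exponent `c > a`, because the degrees
    -- of the generators increase with the `x`-exponent.
    have hac : k - 1 - a + c ≥ k := by
      by_contra hac
      have h1 := stair_antitone i (show c ≤ a by omega)
      rcases hmI with h2 | h2 <;> omega
    have h3 : (x k * y k) ^ (k - 1 - a) * (x k ^ c * y k ^ b * u) =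
        x k ^ (k - 1 - a + c) * (y k ^ (k - 1 - a + b) * u) := by ring
    rw [h3, x_pow_eq_zero hac, zero_mul]

lemma sub_stair_eq_of_iso {i i' : Fin (k - 1) →o ℕ} {n n' : ℤ}
    (h : (monomialModule i n).Iso (monomialModule i' n')) {a : ℕ} (ha : a < k) :
    (a : ℤ) - stair i a - n = a - stair i' a - n' := by
  obtain ⟨e, he⟩ := h
  have h1 : ∀ d, (a : ℤ) - stair i a - n < d ↔ (a : ℤ) - stair i' a - n' < d := by
    intro d
    rw [← xy_pow_smul_eq_zero_iff i n d ha, ← xy_pow_smul_eq_zero_iff i' n' d ha]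
    constructor
    · intro h m hm
      have h2 := h (e.symm m) (by rwa [← he, e.apply_symm_apply])
      simpa using congrArg e h2
    · intro h m hm
      have h2 := h (e m) ((he d m).2 hm)
      rw [← map_smul] at h2
      exact e.map_eq_zero_iff.1 h2
  have h2 := (h1 (a - stair i' a - n' + 1)).2 (by omega)
  have h3 := (h1 (a - stair i a - n + 1)).1 (by omega)
  omega

/-! ### Modules and subsets of `ℤ` -/

lemma exponents_apply (hk : 2 ≤ k) (s : Set.powersetCard ℤ k) (p : Fin (k - 1)) :
    exponents hk s p =
      (entry s ⟨k - 1, by omega⟩ - entry s ⟨k - 2 - p, by omega⟩ - ((p : ℕ) + 1 : ℤ)).toNat :=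
  rfl

lemma sub_stair_exponents (hk : 2 ≤ k) (s : Set.powersetCard ℤ k) (a : Fin k) :
    ((a : ℕ) : ℤ) - stair (exponents hk s) a - ((k : ℤ) - 1 - entry s ⟨k - 1, by omega⟩) =
      entry s a := by
  by_cases ha : (a : ℕ) < k - 1
  · have h := entry_add_le s (a := a) (b := ⟨k - 1, by omega⟩) (Fin.mk_le_mk.2 (by omega))
    rw [stair_of_lt _ ha]
    have h' : (⟨k - 2 - (k - 2 - a), by omega⟩ : Fin k) = a := Fin.ext (by dsimp only; omega)
    rw [exponents_apply]
    dsimp only at h ⊢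
    rw [h']
    omega
  · have h : a = ⟨k - 1, by omega⟩ := Fin.ext (by have := a.2; dsimp only; omega)
    rw [stair_of_le _ (by omega), h]
    dsimp only
    omega

lemma entry_ell (hk : 2 ≤ k) (i : Fin (k - 1) →o ℕ) (n : ℤ) (a : Fin k) :
    entry (ell hk i n) a = ((a : ℕ) : ℤ) - stair i a - n := by
  refine (congrFun (Finset.orderEmbOfFin_unique (ellFinset_card hk i n)
    (f := fun a : Fin k => ((a : ℕ) : ℤ) - stair i a - n) (fun a => ?_) fun a b hab => ?_) a).symm
  · rw [ellFinset, Finset.mem_insert, Finset.mem_image]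
    by_cases ha : (a : ℕ) < k - 1
    · refine Or.inr ⟨⟨k - 2 - a, by omega⟩, Finset.mem_univ _, ?_⟩
      rw [stair_of_lt i ha]
      dsimp only
      omega
    · left
      rw [stair_of_le i (by omega)]
      have := a.2
      omega
  · have h1 := stair_antitone i hab.le
    have h2 : (a : ℕ) < b := hab
    dsimp only
    omega

lemma moduleOf_ell (hk : 2 ≤ k) (i : Fin (k - 1) →o ℕ) (n : ℤ) :
    moduleOf hk (ell hk i n) = monomialModule i n := by
  have h1 : exponents hk (ell hk i n) = i := by
    ext p
    have hp := p.2
    rw [exponents_apply, entry_ell, entry_ell]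
    dsimp only
    rw [stair_of_le i le_rfl, stair_of_lt i (by omega)]
    simp only [show k - 2 - (k - 2 - (p : ℕ)) = p by omega, Fin.eta]
    omega
  have h2 : (k : ℤ) - 1 - entry (ell hk i n) ⟨k - 1, by omega⟩ = n := by
    rw [entry_ell, stair_of_le i le_rfl]
    dsimp only
    omega
  rw [moduleOf, h1, h2]

lemma eq_of_moduleOf_iso (hk : 2 ≤ k) {s t : Set.powersetCard ℤ k}
    (h : (moduleOf hk s).Iso (moduleOf hk t)) : s = t := by
  have h1 : ∀ a, entry s a = entry t a := fun a => by
    rw [← sub_stair_exponents hk s a, ← sub_stair_exponents hk t a]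
    exact sub_stair_eq_of_iso h a.2
  apply Subtype.ext
  rw [← Finset.coe_inj, ← Finset.range_orderEmbOfFin s.1 s.2,
    ← Finset.range_orderEmbOfFin t.1 t.2]
  exact congrArg Set.range (funext h1)

/-- The Plücker relations are quadratic, so they vanish at tangent vectors at the origin; these
separate the coordinates. -/
lemma pluckerCoord_injective :
    Function.Injective (pluckerCoord : Set.powersetCard ℤ k → PluckerAlgebra k) := by
  classical
  intro s t hst
  by_contra hne
  let φ : MvPolynomial (Set.powersetCard ℤ k) ℂ →ₐ[ℂ] DualNumber ℂ :=
    MvPolynomial.aeval fun r => if r = s then DualNumber.eps else 0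
  have hvar : ∀ J : Finset ℤ, ∃ c : ℂ, φ (pluckerVar k J) = c • DualNumber.eps := by
    intro J
    rw [pluckerVar]
    split_ifs with hJ
    · rw [MvPolynomial.aeval_X]
      split_ifs
      · exact ⟨1, (one_smul _ _).symm⟩
      · exact ⟨0, (zero_smul _ _).symm⟩
    · exact ⟨0, by rw [map_zero, zero_smul]⟩
  have hker : pluckerIdeal k ≤ RingHom.ker φ := by
    refine Ideal.span_le.2 ?_
    rintro _ ⟨J, J', -, -, rfl⟩
    rw [SetLike.mem_coe, RingHom.mem_ker, pluckerRelation, map_sum]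
    refine Finset.sum_eq_zero fun j _ => ?_
    obtain ⟨c, hc⟩ := hvar (insert j J')
    obtain ⟨c', hc'⟩ := hvar (J.erase j)
    rw [map_mul, map_mul, hc, hc', smul_mul_smul_comm, DualNumber.eps_mul_eps, smul_zero, mul_zero]
  have h1 := hker (Ideal.Quotient.eq.1 hst)
  rw [RingHom.mem_ker, map_sub, MvPolynomial.aeval_X, MvPolynomial.aeval_X, if_pos rfl,
    if_neg (Ne.symm hne), sub_zero] at h1
  simpa using congrArg TrivSqZeroExt.snd h1

lemma moduleOf_isMCM_and_isGenericallyFree (hk : 2 ≤ k) (s : Set.powersetCard ℤ k) :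
    (moduleOf hk s).IsMCM ∧ (moduleOf hk s).IsGenericallyFree 1 :=
  ⟨monomialModule_isMCM (by omega) _ _, monomialModule_isGenericallyFree (by omega) _ _⟩

lemma classOf_moduleOf_bijective (hk : 2 ≤ k) :
    Function.Bijective fun s : Set.powersetCard ℤ k =>
      classOf (moduleOf hk s) (moduleOf_isMCM_and_isGenericallyFree hk s) := by
  constructor
  · intro s t hst
    exact eq_of_moduleOf_iso hk (Quotient.exact hst)
  · rintro ⟨M, hM, hM'⟩
    obtain ⟨i, n, e, he⟩ := exists_iso_monomialModule_of_isGenericallyFree (by omega) hM hM'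
    refine ⟨ell hk i n, Quotient.sound ?_⟩
    change (moduleOf hk (ell hk i n)).Iso M
    rw [moduleOf_ell]
    exact ⟨e.symm, fun d m => by rw [← he, e.apply_symm_apply]⟩

lemma classOf_congr {M N : GrMod.{0} k} (h : M = N) (hM : M.IsMCM ∧ M.IsGenericallyFree 1)
    (hN : N.IsMCM ∧ N.IsGenericallyFree 1) : classOf M hM = classOf N hN := by
  subst h
  rfl

end GrassInf
end

theorem theorem3p8 (k : ℕ) (hk : 2 ≤ k) :
    (∀ M : GrassInf.GrMod.{u} k, M.IsMCM →
      (M.IsGenericallyFree 1 ↔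
        ∃ (i : Fin (k - 1) →o ℕ) (n : ℤ), M.Iso (GrassInf.monomialModule i n))) ∧
    ∃ Φ : GrassInf.RankOneClass k ≃ GrassInf.PluckerCoordinates k,
      (∀ (i : Fin (k - 1) →o ℕ) (n : ℤ),
        ∃ h : (GrassInf.monomialModule i n).IsMCM ∧
            (GrassInf.monomialModule i n).IsGenericallyFree 1,
          Φ (GrassInf.classOf (GrassInf.monomialModule i n) h) =
            ⟨GrassInf.pluckerCoord (GrassInf.ell hk i n), Set.mem_range_self _⟩) ∧
      (∀ s : Set.powersetCard ℤ k,
        ∃ h : (GrassInf.moduleOf hk s).IsMCM ∧ (GrassInf.moduleOf hk s).IsGenericallyFree 1,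
          Φ.symm ⟨GrassInf.pluckerCoord s, Set.mem_range_self s⟩ =
            GrassInf.classOf (GrassInf.moduleOf hk s) h) := by
  have hk0 : k ≠ 0 := by omega
  refine ⟨fun M hM => ⟨GrassInf.exists_iso_monomialModule_of_isGenericallyFree hk0 hM, ?_⟩, ?_⟩
  · rintro ⟨i, n, h⟩
    exact h.isGenericallyFree_one hk0 (GrassInf.monomialModule_isGenericallyFree hk0 i n)
  · let Ψ : Set.powersetCard ℤ k ≃ GrassInf.RankOneClass k :=
      Equiv.ofBijective _ (GrassInf.classOf_moduleOf_bijective hk)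
    let c : Set.powersetCard ℤ k ≃ GrassInf.PluckerCoordinates k :=
      Equiv.ofInjective _ GrassInf.pluckerCoord_injective
    refine ⟨Ψ.symm.trans c, fun i n => ?_, fun s => ?_⟩
    · have h := And.intro (GrassInf.monomialModule_isMCM hk0 i n)
        (GrassInf.monomialModule_isGenericallyFree hk0 i n)
      have hΨ : GrassInf.classOf (GrassInf.monomialModule i n) h = Ψ (GrassInf.ell hk i n) :=
        GrassInf.classOf_congr (GrassInf.moduleOf_ell hk i n).symm _ _
      refine ⟨h, ?_⟩
      rw [hΨ, Equiv.trans_apply, Equiv.symm_apply_apply]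
      rfl
    · refine ⟨GrassInf.moduleOf_isMCM_and_isGenericallyFree hk s, ?_⟩
      rw [Equiv.symm_trans_apply, Equiv.symm_symm]
      have hc : c.symm ⟨GrassInf.pluckerCoord s, Set.mem_range_self s⟩ = s :=
        c.symm_apply_apply s
      rw [hc]
      rfl
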